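/- Let $\mathcal A$ be a unital $*$-algebra over $\mathbb C$ and let $\varphi,\varphi':\mathcal A\to\mathbb C$ be linear functionals with $\varphi(1)=1$, $\varphi'(1)=0$, $\varphi(a^*a)\ge 0$ and $\varphi'(a^*)=\overline{\varphi'(a)}$ for all $a\in\mathcal A$. For $n\ge 1$ let $NC(n)$ be the set of non-crossing partitions of $\{1,\dots,n\}$, ordered by reverse refinement ($\pi\le\rho$ iff every block of $\rho$ is a union of blocks of $\pi$), with largest element $1_n$ and Möbius function $\mathrm{Möb}$. For $a_1,\dots,a_n\in\mathcal A$ and a block $V=\{v_1<\cdots<v_m\}$ put $a_V:=a_{v_1}\cdots a_{v_m}$. The non-crossing cumulants and the infinitesimal non-crossing cumulants are $$\kappa_n(a_1,\dots,a_n)=\sum_{\pi\in NC(n)}\mathrm{Möb}(\pi,1_n)\prod_{V\in\pi}\varphi(a_V),$$ $$\kappa_n'(a_1,\dots,a_n)=\sum_{\pi\in NC(n)}\sum_{V\in\pi}\mathrm{Möb}(\pi,1_n)\,\varphi'(a_V)\prod_{W\in\pi,\,W\ne V}\varphi(a_W).$$ Unital subalgebras $\mathcal A_1,\dots,\mathcal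 A_k$ of $\mathcal A$ are called infinitesimally free if, for all $n\ge 1$, all indices $i_1\ne i_2,\ i_2\ne i_3,\dots,i_{n-1}\ne i_n$ in $\{1,\dots,k\}$ and all $a_j\in\mathcal A_{i_j}$ with $\varphi(a_1)=\cdots=\varphi(a_n)=0$, one has $\varphi(a_1\cdots a_n)=0$ and $$\varphi'(a_1\cdots a_n)=\varphi(a_1a_n)\,\varphi(a_2a_{n-1})\cdots\varphi(a_{(n-1)/2}\,a_{(n+3)/2})\cdot\varphi'(a_{(n+1)/2})$$ if $n$ is odd and $i_j=i_{n+1-j}$ for all $j$, and $\varphi'(a_1\cdots a_n)=0$ otherwise. Subsets of $\mathcal A$ are called infinitesimally free if the unital subalgebras that they generate are infinitesimally free. Let $x=x^*\in\mathcal A$ be a standard infinitesimally semicircular element, that is, $\kappa_n(x,\dots,x)=\kappa_n'(x,\dots,x)=0$ for all $n\ge 3$, $\kappa_1(x)=0$ and $\kappa_2(x,x)=1$. Let $\mathcal S\subseteq\mathcal A$ be a subset such that $\mathcal S$ and $\{x\}$ are infinitesimally free. Then for every $n\ge 1$ and all $a_1,\dots,a_n\in\mathcal S$, $$\kappa_n(xa_1x,\dots,xa_nx)=\varphi(a_1\cdots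 a_n)$$ and $$\kappa_n'(xa_1x,\dots,xa_nx)=\varphi'(a_1\cdots a_n)+n\,\varphi'(x^2)\,\varphi(a_1\cdots a_n).$$ -/

import Mathlib

namespace InfFree

open Finset

/-! ### Non-crossing partitions and their Möbius function -/

/-- A partition of `{0, …, n-1}` is non-crossing when there are no `a < b < c < d` with
`a, c` in one block and `b, d` in a different block. -/
def IsNonCrossing {n : ℕ} (π : Finpartition (univ : Finset (Fin n))) : Prop :=
  ∀ V ∈ π.parts, ∀ W ∈ π.parts, ∀ a ∈ V, ∀ b ∈ W, ∀ c ∈ V, ∀ d ∈ W,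
    a < b → b < c → c < d → V = W

/-- `NC n` is the set of non-crossing partitions of an ordered set with `n` elements. It carries
the order induced from `Finpartition`: `π ≤ ρ` iff every block of `π` lies in a block of `ρ`
(reverse refinement). -/
abbrev NC (n : ℕ) : Type :=
  {π : Finpartition (univ : Finset (Fin n)) // IsNonCrossing π}

noncomputable instance instFintypeNC (n : ℕ) : Fintype (NC n) := by
  classical exact Subtype.fintype _

noncomputable instance instLocallyFiniteOrderNC (n : ℕ) : LocallyFiniteOrder (NC n) := by
  classical exact Fintype.toLocallyFiniteOrder

/-- The largest element of `NC n` (for `n ≥ 1`: the partition with a single block). -/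
def NC.one (n : ℕ) : NC n :=
  ⟨⊤, fun _ hV _ hW _ _ _ _ _ _ _ _ _ _ _ =>
    Finpartition.parts_top_subsingleton _ hV hW⟩

/-- The Möbius function of the poset `NC n`, with values regarded as complex numbers. -/
noncomputable def moeb {n : ℕ} (π ρ : NC n) : ℂ :=
  IncidenceAlgebra.mu ℂ π ρ

/-! ### Infinitesimal noncommutative probability spaces -/

/-- `(A, φ, φ')` is an infinitesimal noncommutative probability space. -/
structure IsIncps {A : Type*} [Ring A] [Algebra ℂ A] (φ φ' : A →ₗ[ℂ] ℂ) : Prop where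
  map_one : φ 1 = 1
  map_one' : φ' 1 = 0

open scoped ComplexOrder in
/-- `(A, φ, φ')` is a `*`-incps: `A` is a unital complex `*`-algebra, `φ` is positive (so
`φ (a* a)` is a nonnegative real number) and `φ'` is selfadjoint. -/
structure IsStarIncps {A : Type*} [Ring A] [Algebra ℂ A] [StarRing A] [StarModule ℂ A]
    (φ φ' : A →ₗ[ℂ] ℂ) : Prop extends IsIncps φ φ' where
  nonneg : ∀ a : A, 0 ≤ φ (star a * a)
  selfadjoint' : ∀ a : A, φ' (star a) = star (φ' a)

section Cumulants

variable {A : Type*} [Ring A] [Algebra ℂ A]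

/-- The product `a_{v₁} ⋯ a_{vₘ}` of the entries of `a` with index in `V = {v₁ < ⋯ < vₘ}`, taken
in increasing order of the indices. -/
def blockProd {n : ℕ} (a : Fin n → A) (V : Finset (Fin n)) : A :=
  ((V.sort (· ≤ ·)).map a).prod

/-- The `n`-th non-crossing (free) cumulant functional of `φ` (meaningful for `n ≥ 1`). -/
noncomputable def cumulant (φ : A →ₗ[ℂ] ℂ) {n : ℕ} (a : Fin n → A) : ℂ :=
  ∑ π : NC n, moeb π (NC.one n) * ∏ V ∈ π.1.parts, φ (blockProd a V)

/-- The `n`-th infinitesimal non-crossing cumulant functional of `(φ, φ')`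
(meaningful for `n ≥ 1`). -/
noncomputable def infCumulant (φ φ' : A →ₗ[ℂ] ℂ) {n : ℕ} (a : Fin n → A) : ℂ :=
  ∑ π : NC n, ∑ V ∈ π.1.parts,
    moeb π (NC.one n) * φ' (blockProd a V) * ∏ W ∈ π.1.parts.erase V, φ (blockProd a W)

/-! ### Infinitesimal freeness -/

open Classical in
/-- Infinitesimal freeness of a family of unital subalgebras `B i` with respect to `(φ, φ')`.
Indices are counted from `0`: the mirror image of position `j` is `Fin.rev j = n - 1 - j`, and for
odd `n` the middle position is `n / 2`. -/
def InfinitesimallyFree (φ φ' : A →ₗ[ℂ] ℂ) {ι : Type*} (B : ι → Subalgebra ℂ A) : Prop :=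
  ∀ (n : ℕ) (hn : 0 < n) (i : Fin n → ι) (a : Fin n → A),
    (∀ j k : Fin n, (k : ℕ) = j + 1 → i j ≠ i k) →
    (∀ j, a j ∈ B (i j)) →
    (∀ j, φ (a j) = 0) →
      φ (List.ofFn a).prod = 0 ∧
      φ' (List.ofFn a).prod =
        if Odd n ∧ ∀ j, i j = i j.rev then
          (∏ j ∈ univ.filter (fun j : Fin n => (j : ℕ) < n / 2), φ (a j * a j.rev)) *
            φ' (a ⟨n / 2, Nat.div_lt_self hn one_lt_two⟩)
        else 0

/-- Infinitesimal freeness of a family of subsets: the unital subalgebras that they generate are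
infinitesimally free. -/
def InfinitesimallyFreeSets (φ φ' : A →ₗ[ℂ] ℂ) {ι : Type*} (X : ι → Set A) : Prop :=
  InfinitesimallyFree φ φ' (fun i => Algebra.adjoin ℂ (X i))

/-- A selfadjoint element `x` is infinitesimally semicircular when its cumulants and infinitesimal
cumulants of order at least `3` vanish. -/
structure IsInfSemicircular [StarRing A] (φ φ' : A →ₗ[ℂ] ℂ) (x : A) : Prop where
  isSelfAdjoint : IsSelfAdjoint x
  cumulant_eq_zero : ∀ n : ℕ, 3 ≤ n → cumulant φ (fun _ : Fin n => x) = 0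
  infCumulant_eq_zero : ∀ n : ℕ, 3 ≤ n → infCumulant φ φ' (fun _ : Fin n => x) = 0

/-- An infinitesimally semicircular element is standard when moreover `κ₁(x) = 0` and
`κ₂(x, x) = 1`; there is no normalization of `κ₁'` and `κ₂'`. -/
structure IsStandardInfSemicircular [StarRing A] (φ φ' : A →ₗ[ℂ] ℂ) (x : A) : Prop
    extends IsInfSemicircular φ φ' x where
  cumulant_one : cumulant φ ![x] = 0
  cumulant_two : cumulant φ ![x, x] = 1

end Cumulants

end InfFree

/-! Put `ε² = 0` and combine the two functionals into `Φ = φ + εφ'` with values in the dual numbers.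
Infinitesimal cumulants are the `ε`-coefficients of the cumulants of `Φ`, and infinitesimal freeness
of a pair gives ordinary freeness for the extension of `Φ` to dual-number scalars
(`InfinitesimallyFree.isFreePair_dualExtension`). With respect to `Φ`, `x` is semicircular with mean
`μ`, a multiple of `ε`, and variance `t = 1 + φ'(x²)ε`. Both claims thus become one: the `n`-th
cumulant of the `x aᵢ x` is `tⁿ Φ(a₁⋯aₙ)`. Expanding `tⁿ = 1 + nφ'(x²)ε` and comparing coefficients
gives the two formulas.

The cumulant formula follows by Möbius inversion from a moment formula (`map_sandwich`): `Φ(∏ x aᵢ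
x)` is `tⁿ` times the sum over non-crossing partitions of the products of `Φ(a_V)`. Its proof uses
the Schwinger-Dyson equation, which expresses `Φ(u x w)` through `μΦ(uw)` and the pairings of this
`x` with the other occurrences of `x` in `u` and `w`. For powers of `x` this is the recursion for
semicircular moments, and freeness extends it to all words (`IsFreePair.schwingerDyson`). The
pairings are encoded by the free difference quotient, so everything is pulled back to a free
algebra, where that derivation exists without regard to relations in `A`.

The mean disappears by parity. A word with an odd number of `x` has its moment in the ideal `(μ)`,
because modulo `μ` the distribution of `x` is symmetric. The unwanted terms contain either `μ` times
an odd word or a product of two odd words, so they lie in `(μ²) = 0`. What remains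
(`map_sandwich_rec`) is the recursion of the non-crossing sum according to the next element of a
block (`ncSumWith_rec`). -/

namespace InfFree

open Finset

/-! ### Non-crossing partitions of finite sets and the recursion for their weighted sums. -/

section NonCrossing

variable {α : Type*} [LinearOrder α]

/-- `F` is the set of blocks of a non-crossing partition of the finite set `s`. -/
structure IsNCPartition (s : Finset α) (F : Finset (Finset α)) : Prop where
  nonempty : ∀ V ∈ F, V.Nonempty
  subset : ∀ V ∈ F, V ⊆ s
  cover : ∀ a ∈ s, ∃ V ∈ F, a ∈ V
  eq_of_mem : ∀ V ∈ F, ∀ W ∈ F, ∀ a, a ∈ V → a ∈ W → V = W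
  eq_of_cross : ∀ V ∈ F, ∀ W ∈ F, ∀ a ∈ V, ∀ b ∈ W, ∀ c ∈ V, ∀ d ∈ W,
    a < b → b < c → c < d → V = W

open Classical in
/-- The finite set of non-crossing partitions of `s`, each given by its set of blocks. -/
noncomputable def ncPartitions (s : Finset α) : Finset (Finset (Finset α)) :=
  s.powerset.powerset.filter (IsNCPartition s)

lemma mem_ncPartitions {s : Finset α} {F : Finset (Finset α)} :
    F ∈ ncPartitions s ↔ IsNCPartition s F := by
  classical
  simp only [ncPartitions, mem_filter, mem_powerset, and_iff_right_iff_imp]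
  intro h V hV
  exact mem_powerset.2 (h.subset V hV)

variable {R : Type*} [CommRing R]

/-- The sum over the non-crossing partitions of `s` of the product of the weights of the
blocks. -/
noncomputable def ncSum (f : Finset α → R) (s : Finset α) : R :=
  ∑ F ∈ ncPartitions s, ∏ V ∈ F, f V

open Classical in
/-- The non-crossing partitions of `V ∪ s` for which `V` is contained in a block. -/
noncomputable def ncPartitionsWith (V s : Finset α) : Finset (Finset (Finset α)) :=
  (ncPartitions (V ∪ s)).filter fun F => ∃ B ∈ F, V ⊆ B

lemma mem_ncPartitionsWith {V s : Finset α} {F : Finset (Finset α)} :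
    F ∈ ncPartitionsWith V s ↔ IsNCPartition (V ∪ s) F ∧ ∃ B ∈ F, V ⊆ B := by
  classical
  simp [ncPartitionsWith, mem_ncPartitions]

/-- The weighted sum over the non-crossing partitions of `V ∪ s` for which `V` is contained in a
block. -/
noncomputable def ncSumWith (f : Finset α → R) (V s : Finset α) : R :=
  ∑ F ∈ ncPartitionsWith V s, ∏ W ∈ F, f W

/-- If the members of `T` split along `s₁ ⊔ s₂` into members of `T₁` and `T₂`, then the weighted
sum over `T` factorizes. -/
lemma sum_prod_split (f : Finset α → R) {s₁ s₂ : Finset α} (hd : Disjoint s₁ s₂)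
    (T T₁ T₂ : Finset (Finset (Finset α)))
    (h₁ : ∀ F ∈ T₁, ∀ V ∈ F, V.Nonempty ∧ V ⊆ s₁) (h₂ : ∀ F ∈ T₂, ∀ V ∈ F, V.Nonempty ∧ V ⊆ s₂)
    (h : ∀ F, F ∈ T ↔ (∀ V ∈ F, V ⊆ s₁ ∨ V ⊆ s₂) ∧ F.filter (· ⊆ s₁) ∈ T₁ ∧
      F.filter (· ⊆ s₂) ∈ T₂) :
    ∑ F ∈ T, ∏ V ∈ F, f V = (∑ F ∈ T₁, ∏ V ∈ F, f V) * ∑ F ∈ T₂, ∏ V ∈ F, f V := by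
  -- Nonemptiness matters: an empty block would lie in both halves and pass both filters.
  have hne : ∀ V : Finset α, V.Nonempty → V ⊆ s₁ → ¬ V ⊆ s₂ := by
    rintro V ⟨v, hv⟩ k1 k2
    exact disjoint_left.1 hd (k1 hv) (k2 hv)
  have hf₁ : ∀ F₁ ∈ T₁, ∀ F₂ ∈ T₂, (F₁ ∪ F₂).filter (· ⊆ s₁) = F₁ := by
    intro F₁ k1 F₂ k2
    ext V
    have := h₁ F₁ k1 V
    have := h₂ F₂ k2 V
    have := hne V
    simp only [mem_filter, mem_union]
    tauto
  have hf₂ : ∀ F₁ ∈ T₁, ∀ F₂ ∈ T₂, (F₁ ∪ F₂).filter (· ⊆ s₂) = F₂ := by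
    intro F₁ k1 F₂ k2
    ext V
    have := h₁ F₁ k1 V
    have := h₂ F₂ k2 V
    have := hne V
    simp only [mem_filter, mem_union]
    tauto
  have hu : ∀ F ∈ T, F.filter (· ⊆ s₁) ∪ F.filter (· ⊆ s₂) = F := by
    intro F hF
    ext V
    have := ((h F).1 hF).1 V
    simp only [mem_filter, mem_union]
    tauto
  rw [sum_mul_sum, ← sum_product']
  refine sum_nbij' (fun F => (F.filter (· ⊆ s₁), F.filter (· ⊆ s₂))) (fun p => p.1 ∪ p.2)
    ?_ ?_ ?_ ?_ ?_
  · intro F hF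
    exact mem_product.2 ((h F).1 hF).2
  · rintro ⟨F₁, F₂⟩ hp
    obtain ⟨k1, k2⟩ := mem_product.1 hp
    refine (h _).2 ⟨?_, ?_, ?_⟩
    · intro V hV
      rcases mem_union.1 hV with hV | hV
      · exact Or.inl (h₁ _ k1 V hV).2
      · exact Or.inr (h₂ _ k2 V hV).2
    · rw [hf₁ _ k1 _ k2]; exact k1
    · rw [hf₂ _ k1 _ k2]; exact k2
  · exact hu
  · rintro ⟨F₁, F₂⟩ hp
    obtain ⟨k1, k2⟩ := mem_product.1 hp
    simp only [hf₁ _ k1 _ k2, hf₂ _ k1 _ k2]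
  · intro F hF
    obtain ⟨-, k1, k2⟩ := (h F).1 hF
    conv_lhs => rw [← hu F hF]
    refine prod_union (disjoint_left.2 fun V hV hV' => ?_)
    exact hne V (h₁ _ k1 V hV).1 (h₁ _ k1 V hV).2 (h₂ _ k2 V hV').2

lemma IsNCPartition.filter {s s₁ : Finset α} {F : Finset (Finset α)} (h : IsNCPartition s F)
    (hs : s₁ ⊆ s) (hF : ∀ V ∈ F, ∀ a ∈ V, a ∈ s₁ → V ⊆ s₁) :
    IsNCPartition s₁ (F.filter (· ⊆ s₁)) where
  nonempty V hV := h.nonempty V (mem_filter.1 hV).1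
  subset V hV := (mem_filter.1 hV).2
  cover a ha := by
    obtain ⟨V, hV, haV⟩ := h.cover a (hs ha)
    exact ⟨V, mem_filter.2 ⟨hV, hF V hV a haV ha⟩, haV⟩
  eq_of_mem V hV W hW := h.eq_of_mem V (mem_filter.1 hV).1 W (mem_filter.1 hW).1
  eq_of_cross V hV W hW := h.eq_of_cross V (mem_filter.1 hV).1 W (mem_filter.1 hW).1

/-- Glueing of non-crossing partitions of two disjoint sets. -/
lemma IsNCPartition.glue {s s₁ s₂ : Finset α} (hd : Disjoint s₁ s₂) (hs : s₁ ∪ s₂ = s)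
    {F : Finset (Finset α)} (hF : ∀ V ∈ F, V ⊆ s₁ ∨ V ⊆ s₂)
    (h₁ : IsNCPartition s₁ (F.filter (· ⊆ s₁))) (h₂ : IsNCPartition s₂ (F.filter (· ⊆ s₂)))
    (hc₁ : ∀ V ∈ F, ∀ W ∈ F, V ⊆ s₁ → W ⊆ s₂ → ∀ a ∈ V, ∀ b ∈ W, ∀ c ∈ V, ∀ d ∈ W,
      a < b → b < c → c < d → False)
    (hc₂ : ∀ V ∈ F, ∀ W ∈ F, V ⊆ s₁ → W ⊆ s₂ → ∀ a ∈ W, ∀ b ∈ V, ∀ c ∈ W, ∀ d ∈ V,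
      a < b → b < c → c < d → False) :
    IsNCPartition s F where
  nonempty V hV := by
    rcases hF V hV with h | h
    · exact h₁.nonempty V (mem_filter.2 ⟨hV, h⟩)
    · exact h₂.nonempty V (mem_filter.2 ⟨hV, h⟩)
  subset V hV := by
    rw [← hs]
    rcases hF V hV with h | h
    · exact h.trans subset_union_left
    · exact h.trans subset_union_right
  cover a ha := by
    rw [← hs] at ha
    rcases mem_union.1 ha with h | h
    · obtain ⟨V, hV, k⟩ := h₁.cover a h
      exact ⟨V, (mem_filter.1 hV).1, k⟩
    · obtain ⟨V, hV, k⟩ := h₂.cover a h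
      exact ⟨V, (mem_filter.1 hV).1, k⟩
  eq_of_mem V hV W hW a ha ha' := by
    rcases hF V hV with h | h <;> rcases hF W hW with h' | h'
    · exact h₁.eq_of_mem V (mem_filter.2 ⟨hV, h⟩) W (mem_filter.2 ⟨hW, h'⟩) a ha ha'
    · exact (disjoint_left.1 hd (h ha) (h' ha')).elim
    · exact (disjoint_left.1 hd (h' ha') (h ha)).elim
    · exact h₂.eq_of_mem V (mem_filter.2 ⟨hV, h⟩) W (mem_filter.2 ⟨hW, h'⟩) a ha ha'
  eq_of_cross V hV W hW a ha b hb c hc d hd' hab hbc hcd := by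
    rcases hF V hV with h | h <;> rcases hF W hW with h' | h'
    · exact h₁.eq_of_cross V (mem_filter.2 ⟨hV, h⟩) W (mem_filter.2 ⟨hW, h'⟩)
        a ha b hb c hc d hd' hab hbc hcd
    · exact (hc₁ V hV W hW h h' a ha b hb c hc d hd' hab hbc hcd).elim
    · exact (hc₂ W hW V hV h' h a ha b hb c hc d hd' hab hbc hcd).elim
    · exact h₂.eq_of_cross V (mem_filter.2 ⟨hV, h⟩) W (mem_filter.2 ⟨hW, h'⟩)
        a ha b hb c hc d hd' hab hbc hcd

/-- The weighted sum over the non-crossing partitions finer than a non-crossing partition `σ` is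
the product over the blocks of `σ`. -/
lemma sum_refining_eq_prod (f : Finset α → R) (σ : Finset (Finset α)) :
    ∀ (s : Finset α) [DecidablePred fun F : Finset (Finset α) => ∀ W ∈ F, ∃ V ∈ σ, W ⊆ V],
      IsNCPartition s σ →
      ∑ F ∈ (ncPartitions s).filter (fun F => ∀ W ∈ F, ∃ V ∈ σ, W ⊆ V), ∏ W ∈ F, f W =
        ∏ V ∈ σ, ncSum f V := by
  classical
  induction σ using Finset.induction_on with
  | empty =>
    intro s _ hs
    have hs0 : s = ∅ := eq_empty_of_forall_notMem fun a ha => by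
      obtain ⟨V, hV, -⟩ := hs.cover a ha
      simp at hV
    have : (ncPartitions s).filter (fun F => ∀ W ∈ F, ∃ V ∈ (∅ : Finset (Finset α)), W ⊆ V)
        = {∅} := by
      ext F
      simp only [mem_filter, mem_ncPartitions, notMem_empty, false_and, exists_false, imp_false,
        mem_singleton]
      constructor
      · rintro ⟨-, h⟩
        exact eq_empty_of_forall_notMem h
      · rintro rfl
        exact ⟨hs, by simp⟩
    rw [this]
    simp
  | insert V σ hV ih =>
    intro s _ hs
    have hVs : V ⊆ s := hs.subset V (mem_insert_self _ _)
    have hdis : ∀ W ∈ σ, Disjoint W V := by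
      intro W hW
      rw [disjoint_left]
      intro a ha ha'
      have := hs.eq_of_mem W (mem_insert_of_mem hW) V (mem_insert_self _ _) a ha ha'
      exact hV (this ▸ hW)
    have hσ : IsNCPartition (s \ V) σ :=
      { nonempty := fun W hW => hs.nonempty W (mem_insert_of_mem hW)
        subset := fun W hW a ha => mem_sdiff.2 ⟨hs.subset W (mem_insert_of_mem hW) ha,
          disjoint_left.1 (hdis W hW) ha⟩
        cover := fun a ha => by
          obtain ⟨W, hW, haW⟩ := hs.cover a (mem_sdiff.1 ha).1
          rcases mem_insert.1 hW with rfl | hW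
          · exact ((mem_sdiff.1 ha).2 haW).elim
          · exact ⟨W, hW, haW⟩
        eq_of_mem := fun W hW W' hW' => hs.eq_of_mem W (mem_insert_of_mem hW) W'
          (mem_insert_of_mem hW')
        eq_of_cross := fun W hW W' hW' => hs.eq_of_cross W (mem_insert_of_mem hW) W'
          (mem_insert_of_mem hW') }
    rw [prod_insert hV, ← ih _ hσ]
    -- A refinement consists of a partition of the block `V` and a refinement of `σ` on the
    -- remaining points. A crossing between the two would force a crossing between `V` and a block
    -- of `σ`.
    refine sum_prod_split f (disjoint_sdiff (s := V) (t := s)) _ _ _ ?_ ?_ ?_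
    · intro F hF W hW
      rw [mem_ncPartitions] at hF
      exact ⟨hF.nonempty W hW, hF.subset W hW⟩
    · intro F hF W hW
      rw [mem_filter, mem_ncPartitions] at hF
      exact ⟨hF.1.nonempty W hW, hF.1.subset W hW⟩
    · intro F
      simp only [mem_filter, mem_ncPartitions]
      constructor
      · rintro ⟨hF, href⟩
        have hsplit : ∀ W ∈ F, W ⊆ V ∨ ∃ V' ∈ σ, W ⊆ V' := by
          intro W hW
          obtain ⟨V', hV', hWV'⟩ := href W hW
          rcases mem_insert.1 hV' with rfl | hV'
          · exact Or.inl hWV'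
          · exact Or.inr ⟨V', hV', hWV'⟩
        refine ⟨?_, ?_, ?_, ?_⟩
        · intro W hW
          rcases hsplit W hW with h | ⟨V', hV', h⟩
          · exact Or.inl h
          · exact Or.inr (h.trans (hσ.subset V' hV'))
        · refine hF.filter hVs fun W hW a ha haV => ?_
          rcases hsplit W hW with h | ⟨V', hV', h⟩
          · exact h
          · exact (disjoint_left.1 (hdis V' hV') (h ha) haV).elim
        · refine hF.filter sdiff_subset fun W hW a ha haV => ?_
          rcases hsplit W hW with h | ⟨V', hV', h⟩
          · exact ((mem_sdiff.1 haV).2 (h ha)).elim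
          · exact h.trans (hσ.subset V' hV')
        · rintro W ⟨hW, hWs⟩
          rcases hsplit W hW with h | h
          · obtain ⟨w, hw⟩ := hF.nonempty W hW
            exact ((mem_sdiff.1 (hWs hw)).2 (h hw)).elim
          · exact h
      · rintro ⟨hsub, hF₁, hF₂, href⟩
        refine ⟨IsNCPartition.glue disjoint_sdiff (union_sdiff_of_subset hVs) hsub hF₁ hF₂
          ?_ ?_, ?_⟩
        · intro W hW W' hW' h h' a ha b hb c hc d hd hab hbc hcd
          obtain ⟨V', hV', hW'V'⟩ := href W' ⟨hW', h'⟩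
          have := hs.eq_of_cross V (mem_insert_self _ _) V' (mem_insert_of_mem hV')
            a (h ha) b (hW'V' hb) c (h hc) d (hW'V' hd) hab hbc hcd
          exact hV (this ▸ hV')
        · intro W hW W' hW' h h' a ha b hb c hc d hd hab hbc hcd
          obtain ⟨V', hV', hW'V'⟩ := href W' ⟨hW', h'⟩
          have := hs.eq_of_cross V' (mem_insert_of_mem hV') V (mem_insert_self _ _)
            a (hW'V' ha) b (h hb) c (hW'V' hc) d (h hd) hab hbc hcd
          exact hV (this ▸ hV')
        · intro W hW
          rcases hsub W hW with h | h
          · exact ⟨V, mem_insert_self _ _, h⟩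
          · obtain ⟨V', hV', k⟩ := href W ⟨hW, h⟩
            exact ⟨V', mem_insert_of_mem hV', k⟩

lemma ncSum_empty (f : Finset α → R) : ncSum f ∅ = 1 := by
  have : ncPartitions (∅ : Finset α) = {∅} := by
    ext F
    rw [mem_ncPartitions, mem_singleton]
    constructor
    · intro h
      refine eq_empty_of_forall_notMem fun V hV => ?_
      obtain ⟨v, hv⟩ := h.nonempty V hV
      simpa using h.subset V hV hv
    · rintro rfl
      exact ⟨by simp, by simp, by simp, by simp, by simp⟩
  simp [ncSum, this]

/-- Some block always contains `m`, so the constraint on `{m}` is vacuous. Applied with `m` the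
minimum, this starts the recursion `ncSumWith_rec`. -/
lemma ncSum_insert_min (f : Finset α → R) (m : α) (s : Finset α) :
    ncSum f (insert m s) = ncSumWith f {m} s := by
  classical
  unfold ncSum ncSumWith
  refine sum_congr ?_ fun _ _ => rfl
  ext F
  rw [mem_ncPartitions, mem_ncPartitionsWith, ← insert_eq]
  refine ⟨fun h => ⟨h, ?_⟩, fun h => h.1⟩
  obtain ⟨B, hB, hm⟩ := h.cover m (mem_insert_self _ _)
  exact ⟨B, hB, by simpa using hm⟩

/-- The case in which the block of `V` is complete. As `V` lies to the left of `s`, it crosses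
nothing, and the partition of `s` is arbitrary. -/
lemma sum_ncPartitionsWith_mem (f : Finset α → R) {V s : Finset α} (hV : V.Nonempty)
    (hVs : ∀ v ∈ V, ∀ a ∈ s, v < a) :
    ∑ F ∈ (ncPartitionsWith V s).filter (V ∈ ·), ∏ W ∈ F, f W = f V * ncSum f s := by
  classical
  have hd : Disjoint V s := disjoint_left.2 fun a ha ha' => lt_irrefl a (hVs a ha a ha')
  have : f V = ∑ F ∈ ({{V}} : Finset (Finset (Finset α))), ∏ W ∈ F, f W := by simp
  rw [this]
  refine sum_prod_split f hd _ _ _ ?_ ?_ ?_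
  · intro F hF W hW
    rw [mem_singleton] at hF
    subst hF
    rw [mem_singleton] at hW
    subst hW
    exact ⟨hV, Subset.rfl⟩
  · intro F hF W hW
    rw [mem_ncPartitions] at hF
    exact ⟨hF.nonempty W hW, hF.subset W hW⟩
  · intro F
    simp only [mem_filter, mem_ncPartitionsWith, mem_ncPartitions, mem_singleton]
    constructor
    · rintro ⟨⟨hF, -⟩, hVF⟩
      have hsub : ∀ W ∈ F, W = V ∨ W ⊆ s := by
        intro W hW
        by_cases h : W = V
        · exact Or.inl h
        · refine Or.inr fun a ha => ?_
          rcases mem_union.1 (hF.subset W hW ha) with k | k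
          · exact (h (hF.eq_of_mem W hW V hVF a ha k)).elim
          · exact k
      refine ⟨fun W hW => (hsub W hW).imp (fun h => h.subset) id, ?_, ?_⟩
      · ext W
        simp only [mem_filter, mem_singleton]
        constructor
        · rintro ⟨hW, hWV⟩
          obtain ⟨w, hw⟩ := hF.nonempty W hW
          exact hF.eq_of_mem W hW V hVF w hw (hWV hw)
        · rintro rfl
          exact ⟨hVF, Subset.rfl⟩
      · refine hF.filter subset_union_right fun W hW a ha has => ?_
        rcases hsub W hW with rfl | h
        · exact (disjoint_left.1 hd ha has).elim
        · exact h
    · rintro ⟨hsub, h1, h2⟩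
      have hVF : V ∈ F := by
        have : V ∈ F.filter (· ⊆ V) := by rw [h1]; simp
        exact (mem_filter.1 this).1
      refine ⟨⟨IsNCPartition.glue hd rfl hsub ?_ h2 ?_ ?_, V, hVF, Subset.rfl⟩, hVF⟩
      · rw [h1]
        refine ⟨by simpa using hV, by simp, by simp, ?_, ?_⟩
        · simp only [mem_singleton]
          rintro W rfl W' rfl
          simp
        · simp only [mem_singleton]
          rintro W rfl W' rfl
          simp
      · intro W hW W' hW' h h' a ha b hb c hc d hd hab hbc hcd
        exact lt_asymm hbc (hVs c (h hc) b (h' hb))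
      · intro W hW W' hW' h h' a ha b hb c hc d hd hab hbc hcd
        exact lt_asymm hab (hVs b (h hb) a (h' ha))

/-- The case in which the block of `V` continues with `k`. The points of `s` below `k` lie in a gap
of this block, so they are partitioned on their own, while `insert k V` is the new initial segment
for the points above `k`. -/
lemma sum_ncPartitionsWith_gap (f : Finset α → R) {V s : Finset α}
    (hVs : ∀ v ∈ V, ∀ a ∈ s, v < a) {k : α} (hk : k ∈ s) :
    ∑ F ∈ (ncPartitionsWith V s).filter (fun F => (∃ B ∈ F, insert k V ⊆ B) ∧
        ∀ W ∈ F, W ⊆ s.filter (· < k) ∨ W ⊆ insert k V ∪ s.filter (k < ·)), ∏ W ∈ F, f W =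
      ncSum f (s.filter (· < k)) * ncSumWith f (insert k V) (s.filter (k < ·)) := by
  classical
  have hd : Disjoint (s.filter (· < k)) (insert k V ∪ s.filter (k < ·)) := by
    refine disjoint_left.2 fun a ha ha' => ?_
    simp only [mem_filter, mem_union, mem_insert] at ha ha'
    rcases ha' with (rfl | h) | h
    · exact lt_irrefl _ ha.2
    · exact lt_irrefl _ (hVs a h a ha.1)
    · exact lt_asymm ha.2 h.2
  have hu : s.filter (· < k) ∪ (insert k V ∪ s.filter (k < ·)) = V ∪ s := by
    ext a
    simp only [mem_filter, mem_union, mem_insert]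
    constructor
    · rintro (h | (rfl | h) | h)
      · exact Or.inr h.1
      · exact Or.inr hk
      · exact Or.inl h
      · exact Or.inr h.1
    · rintro (h | h)
      · exact Or.inr (Or.inl (Or.inr h))
      · rcases lt_trichotomy a k with h' | h' | h'
        · exact Or.inl ⟨h, h'⟩
        · exact Or.inr (Or.inl (Or.inl h'))
        · exact Or.inr (Or.inr ⟨h, h'⟩)
  have hgap : ∀ a ∈ s.filter (· < k), ∀ c ∈ s.filter (· < k),
      ∀ b ∈ insert k V ∪ s.filter (k < ·), a < b → b < c → False := by
    intro a ha c hc b hb hab hbc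
    simp only [mem_filter, mem_union, mem_insert] at ha hb hc
    rcases hb with (rfl | h) | h
    · exact lt_asymm hbc hc.2
    · exact lt_asymm hab (hVs b h a ha.1)
    · exact lt_asymm (hbc.trans hc.2) h.2
  refine sum_prod_split f hd _ _ _ ?_ ?_ ?_
  · intro F hF W hW
    rw [mem_ncPartitions] at hF
    exact ⟨hF.nonempty W hW, hF.subset W hW⟩
  · intro F hF W hW
    rw [mem_ncPartitionsWith] at hF
    exact ⟨hF.1.nonempty W hW, hF.1.subset W hW⟩
  · intro F
    simp only [mem_filter (s := ncPartitionsWith V s), mem_ncPartitionsWith, mem_ncPartitions]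
    constructor
    · rintro ⟨⟨hF, -⟩, ⟨B, hB, hkB⟩, hsub⟩
      refine ⟨hsub, ?_, ?_, ?_⟩
      · refine hF.filter (hu ▸ subset_union_left) fun W hW a ha has => ?_
        rcases hsub W hW with h | h
        · exact h
        · exact (disjoint_left.1 hd has (h ha)).elim
      · refine hF.filter (hu ▸ subset_union_right) fun W hW a ha has => ?_
        rcases hsub W hW with h | h
        · exact (disjoint_left.1 hd (h ha) has).elim
        · exact h
      · refine ⟨B, mem_filter.2 ⟨hB, ?_⟩, hkB⟩
        rcases hsub B hB with h | h
        · have := h (hkB (mem_insert_self k V))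
          simp at this
        · exact h
    · rintro ⟨hsub, h1, h2, B, hB, hkB⟩
      have hB' := (mem_filter.1 hB).1
      refine ⟨⟨IsNCPartition.glue hd hu hsub h1 h2 ?_ ?_, B, hB', (subset_insert _ _).trans hkB⟩,
        ⟨B, hB', hkB⟩, hsub⟩
      · intro W hW W' hW' h h' a ha b hb c hc d hd hab hbc hcd
        exact hgap a (h ha) c (h hc) b (h' hb) hab hbc
      · intro W hW W' hW' h h' a ha b hb c hc d hd hab hbc hcd
        exact hgap b (h hb) d (h hd) c (h' hc) hbc hcd

/-- Recursion for the weighted sums, according to the element that follows `V` in the block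
containing `V`. -/
lemma ncSumWith_rec (f : Finset α → R) {V s : Finset α} (hV : V.Nonempty)
    (hVs : ∀ v ∈ V, ∀ a ∈ s, v < a) :
    ncSumWith f V s = f V * ncSum f s +
      ∑ k ∈ s, ncSum f (s.filter (· < k)) * ncSumWith f (insert k V) (s.filter (k < ·)) := by
  classical
  rw [← sum_ncPartitionsWith_mem f hV hVs,
    ← sum_congr rfl fun k hk => sum_ncPartitionsWith_gap f hVs hk]
  have hVk : ∀ k ∈ s, k ∉ V := fun k hk hk' => lt_irrefl k (hVs k hk' k hk)
  rw [← sum_biUnion, ← sum_union]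
  · unfold ncSumWith
    refine sum_congr ?_ fun _ _ => rfl
    ext F
    simp only [mem_union, mem_biUnion, mem_filter (s := ncPartitionsWith V s)]
    constructor
    · intro hF
      obtain ⟨hF', B, hB, hVB⟩ := mem_ncPartitionsWith.1 hF
      by_cases hBV : B = V
      · exact Or.inl ⟨hF, hBV ▸ hB⟩
      · right
        -- The element `k` that indexes the case is the smallest element of the block outside `V`.
        have hne : (B \ V).Nonempty := by
          rw [sdiff_nonempty]
          exact fun h => hBV (Subset.antisymm h hVB)
        obtain ⟨hkB, hkV⟩ := mem_sdiff.1 (min'_mem _ hne)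
        have hmin : ∀ b ∈ B, b ∉ V → (B \ V).min' hne ≤ b :=
          fun b hb hbV => min'_le _ _ (mem_sdiff.2 ⟨hb, hbV⟩)
        generalize (B \ V).min' hne = k at hkB hkV hmin
        have hks : k ∈ s := (mem_union.1 (hF'.subset B hB hkB)).resolve_left hkV
        refine ⟨k, hks, hF, ⟨B, hB, insert_subset hkB hVB⟩, fun W hW => ?_⟩
        by_cases hWB : W = B
        · subst hWB
          right
          intro b hb
          simp only [mem_union, mem_insert, mem_filter]
          by_cases hbV : b ∈ V
          · exact Or.inl (Or.inr hbV)
          · have hbs := (mem_union.1 (hF'.subset W hW hb)).resolve_left hbV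
            rcases (hmin b hb hbV).eq_or_lt with h | h
            · exact Or.inl (Or.inl h.symm)
            · exact Or.inr ⟨hbs, h⟩
        · have hWs : ∀ w ∈ W, w ∈ s := fun w hw =>
            (mem_union.1 (hF'.subset W hW hw)).resolve_left
              fun h => hWB (hF'.eq_of_mem W hW B hB w hw (hVB h))
          have hWk : ∀ w ∈ W, w ≠ k := by
            rintro w hw rfl
            exact hWB (hF'.eq_of_mem W hW B hB w hw hkB)
          by_cases hp : ∃ p ∈ W, p < k
          · obtain ⟨p, hp, hpk⟩ := hp
            left
            intro q hq
            refine mem_filter.2 ⟨hWs q hq, ?_⟩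
            by_contra hqk
            have hkq : k < q := lt_of_le_of_ne (not_lt.1 hqk) (hWk q hq).symm
            -- A block with points `p < k < q` would cross `B` through `v < p < k < q`.
            obtain ⟨v, hv⟩ := hV
            exact hWB (hF'.eq_of_cross B hB W hW v (hVB hv) p hp k hkB q hq
              (hVs v hv p (hWs p hp)) hpk hkq).symm
          · right
            intro q hq
            refine mem_union_right _ (mem_filter.2 ⟨hWs q hq, ?_⟩)
            push Not at hp
            exact lt_of_le_of_ne (hp q hq) (hWk q hq).symm
    · rintro (h | ⟨k, -, h⟩)
      · exact h.1
      · exact h.1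
  · rw [disjoint_left]
    intro F hF hF'
    simp only [mem_biUnion, mem_filter (s := ncPartitionsWith V s)] at hF hF'
    obtain ⟨hF0, hVF⟩ := hF
    obtain ⟨k, hk, -, ⟨B, hB, hkB⟩, -⟩ := hF'
    obtain ⟨v, hv⟩ := hV
    have := (mem_ncPartitionsWith.1 hF0).1.eq_of_mem V hVF B hB v hv
      (hkB (mem_insert_of_mem hv))
    subst this
    exact hVk k hk (hkB (mem_insert_self _ _))
  -- The cases are disjoint: if both `k < j` qualified, they would lie in one block, but in the case
  -- of `j` a block containing `j` has no point of `s` below `j`.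
  · have key : ∀ k ∈ s, ∀ j ∈ s, k < j → ∀ F,
        ((∃ B ∈ F, insert k V ⊆ B) → F ∈ ncPartitionsWith V s → (∃ B ∈ F, insert j V ⊆ B) →
        (∀ W ∈ F, W ⊆ s.filter (· < j) ∨ W ⊆ insert j V ∪ s.filter (j < ·)) → False) := by
      rintro k hk j hj hkj F ⟨B, hB, hkB⟩ hF ⟨B', hB', hjB'⟩ hsub
      obtain ⟨v, hv⟩ := hV
      have := (mem_ncPartitionsWith.1 hF).1.eq_of_mem B hB B' hB' v
        (hkB (mem_insert_of_mem hv)) (hjB' (mem_insert_of_mem hv))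
      subst this
      rcases hsub B hB with h | h
      · have := h (hjB' (mem_insert_self _ _))
        simp at this
      · have := h (hkB (mem_insert_self _ _))
        simp only [mem_union, mem_insert, mem_filter] at this
        rcases this with (rfl | h') | h'
        · exact lt_irrefl _ hkj
        · exact hVk k hk h'
        · exact lt_asymm hkj h'.2
    intro k hk j hj hkj
    simp only [Function.onFun]
    rw [disjoint_left]
    intro F hF hF'
    simp only [mem_filter (s := ncPartitionsWith V s)] at hF hF'
    rcases lt_or_gt_of_ne hkj with h | h
    · exact key k hk j hj h F hF.2.1 hF.1 hF'.2.1 hF'.2.2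
    · exact key j hj k hk h F hF'.2.1 hF.1 hF.2.1 hF.2.2

end NonCrossing

/-! ### Semicircular moments as non-crossing sums. -/

section NonCrossing

variable {α : Type*} [LinearOrder α] {R : Type*} [CommRing R]

/-- The moments of a semicircular element with first two free cumulants `c₁` and `c₂`. -/
def semicircleMoment (c₁ c₂ : R) : ℕ → R
  | 0 => 1
  | k + 1 => c₁ * semicircleMoment c₁ c₂ k +
      c₂ * ∑ i : Fin k, semicircleMoment c₁ c₂ i * semicircleMoment c₁ c₂ (k - 1 - i)

lemma semicircleMoment_zero (c₁ c₂ : R) : semicircleMoment c₁ c₂ 0 = 1 := by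
  rw [semicircleMoment]

lemma semicircleMoment_succ (c₁ c₂ : R) (k : ℕ) :
    semicircleMoment c₁ c₂ (k + 1) = c₁ * semicircleMoment c₁ c₂ k +
      c₂ * ∑ i ∈ range k, semicircleMoment c₁ c₂ i * semicircleMoment c₁ c₂ (k - 1 - i) := by
  rw [semicircleMoment,
    ← Fin.sum_univ_eq_sum_range
      (fun i => semicircleMoment c₁ c₂ i * semicircleMoment c₁ c₂ (k - 1 - i))]

/-- The rank `k ↦ #{a ∈ s | a < k}` is a bijection from `s` onto `range s.card`. This turns sums
over the position of `k` into the convolution sum of the moment recursion. -/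
lemma sum_card_filter_lt (s : Finset α) (g : ℕ → R) :
    ∑ k ∈ s, g (s.filter (· < k)).card = ∑ i ∈ range s.card, g i := by
  induction s using Finset.induction_on_max with
  | empty => simp
  | insert a s ha ih =>
    have has : a ∉ s := fun h => lt_irrefl _ (ha a h)
    rw [sum_insert has, card_insert_of_notMem has, sum_range_succ, ← ih, add_comm]
    congr 1
    · refine sum_congr rfl fun k hk => ?_
      rw [filter_insert, if_neg (lt_asymm (ha k hk))]
    · rw [filter_insert, if_neg (lt_irrefl a), filter_true_of_mem ha]

lemma card_filter_lt_add_card_filter_gt {s : Finset α} {k : α} (hk : k ∈ s) :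
    (s.filter (· < k)).card + (s.filter (k < ·)).card + 1 = s.card := by
  have h : s = insert k (s.filter (· < k) ∪ s.filter (k < ·)) := by
    ext a
    simp only [mem_insert, mem_union, mem_filter]
    constructor
    · intro ha
      rcases lt_trichotomy a k with h | h | h <;> simp [ha, h]
    · rintro (rfl | h | h)
      exacts [hk, h.1, h.1]
  have hd : Disjoint (s.filter (· < k)) (s.filter (k < ·)) := by
    rw [disjoint_left]
    intro a ha ha'
    exact lt_asymm (mem_filter.1 ha).2 (mem_filter.1 ha').2
  have := congrArg card h
  rw [card_insert_of_notMem (by simp), card_union_of_disjoint hd] at this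
  exact this.symm

lemma card_filter_gt {s : Finset α} {k : α} (hk : k ∈ s) :
    (s.filter (k < ·)).card = s.card - 1 - (s.filter (· < k)).card := by
  have := card_filter_lt_add_card_filter_gt hk
  omega

lemma ncSumWith_eq_zero (f : Finset α → R) (V s : Finset α) (h : ∀ W, V ⊆ W → f W = 0) :
    ncSumWith f V s = 0 := by
  refine sum_eq_zero fun F hF => ?_
  obtain ⟨-, B, hB, hVB⟩ := mem_ncPartitionsWith.1 hF
  exact prod_eq_zero hB (h B hVB)

/-- Weights which only depend on the size of the block and vanish for blocks with at least three
elements produce the semicircular moments. -/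
lemma ncSum_card (c : ℕ → R) (hc : ∀ k, 3 ≤ k → c k = 0) (s : Finset α) :
    ncSum (fun V => c V.card) s = semicircleMoment (c 1) (c 2) s.card := by
  induction hn : s.card using Nat.strong_induction_on generalizing s with
  | _ n ih =>
    induction s using Finset.induction_on_min with
    | empty => rw [ncSum_empty, ← hn, card_empty, semicircleMoment_zero]
    | insert m s hm _ =>
      have hms : m ∉ s := fun h => lt_irrefl _ (hm m h)
      rw [card_insert_of_notMem hms] at hn
      have hs : s.card < n := by omega
      have hlt : ∀ k, (s.filter (· < k)).card < n :=
        fun k => (card_le_card (filter_subset _ _)).trans_lt hs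
      have hgt : ∀ k, (s.filter (k < ·)).card < n :=
        fun k => (card_le_card (filter_subset _ _)).trans_lt hs
      -- Once `k` has joined `m`, the block must stop: a third element gives weight zero. So the
      -- block of the minimum is a singleton or a pair, as in the recursion for `semicircleMoment`.
      have hpair : ∀ k ∈ s, ncSumWith (fun V => c V.card) (insert k {m}) (s.filter (k < ·)) =
          c 2 * semicircleMoment (c 1) (c 2) (s.filter (k < ·)).card := by
        intro k hk
        have hkm : k ≠ m := fun h => hms (h ▸ hk)
        have hcard : (insert k ({m} : Finset α)).card = 2 := by
          rw [card_insert_of_notMem (by simpa using hkm), card_singleton]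
        have hlt' : ∀ v ∈ insert k ({m} : Finset α), ∀ a ∈ s.filter (k < ·), v < a := by
          intro v hv a ha
          rcases mem_insert.1 hv with rfl | hv
          · exact (mem_filter.1 ha).2
          · rw [mem_singleton.1 hv]
            exact hm a (mem_filter.1 ha).1
        rw [ncSumWith_rec _ (insert_nonempty _ _) hlt', hcard, ih _ (hgt k) _ rfl, sum_eq_zero,
          add_zero]
        intro j hj
        rw [ncSumWith_eq_zero, mul_zero]
        intro W hW
        refine hc _ (le_trans ?_ (card_le_card hW))
        rw [card_insert_of_notMem, hcard]
        exact fun h => lt_irrefl _ (hlt' j h j hj)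
      rw [ncSum_insert_min, ncSumWith_rec _ (singleton_nonempty m) (by simpa using hm), ← hn,
        semicircleMoment_succ, card_singleton, ih _ hs _ rfl,
        ← sum_card_filter_lt s (fun i => semicircleMoment (c 1) (c 2) i *
          semicircleMoment (c 1) (c 2) (s.card - 1 - i)), mul_sum]
      congr 1
      refine sum_congr rfl fun k hk => ?_
      rw [hpair k hk, ih _ (hlt k) _ rfl, ← card_filter_gt hk]
      ring

end NonCrossing

/-! ### Möbius inversion on the lattice of non-crossing partitions. -/

section Moebius

variable {n : ℕ}

lemma NC.le_one (π : NC n) : π ≤ NC.one n :=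
  show π.1 ≤ ⊤ from le_top

lemma NC.isNCPartition (π : NC n) : IsNCPartition univ π.1.parts where
  nonempty _ hV := π.1.nonempty_of_mem_parts hV
  subset _ _ := subset_univ _
  cover _ ha := π.1.exists_mem ha
  eq_of_mem _ hV _ hW _ ha ha' := π.1.eq_of_mem_parts hV hW ha ha'
  eq_of_cross := π.2

/-- The element of `NC n` with a given set of blocks. -/
def NC.ofIsNCPartition {F : Finset (Finset (Fin n))} (h : IsNCPartition univ F) : NC n :=
  ⟨Finpartition.ofExistsUnique F h.subset
    (fun a ha => by
      obtain ⟨V, hV, haV⟩ := h.cover a ha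
      exact ⟨V, ⟨hV, haV⟩, fun W hW => h.eq_of_mem W hW.1 V hV a hW.2 haV⟩)
    (fun h0 => by simpa using h.nonempty ∅ h0), h.eq_of_cross⟩

lemma NC.parts_one (hn : 1 ≤ n) : (NC.one n).1.parts = {univ} := by
  refine Subset.antisymm (Finpartition.parts_top_subset _) (singleton_subset_iff.2 ?_)
  obtain ⟨V, hV, -⟩ := (NC.one n).1.exists_mem (mem_univ (⟨0, hn⟩ : Fin n))
  exact mem_singleton.1 (Finpartition.parts_top_subset _ hV) ▸ hV

lemma NC.ne_univ_of_ne_one (hn : 1 ≤ n) {π : NC n} (hπ : π ≠ NC.one n)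
    {V : Finset (Fin n)} (hV : V ∈ π.1.parts) : V ≠ univ := by
  rintro rfl
  refine hπ (Subtype.ext (Finpartition.ext ?_))
  rw [NC.parts_one hn]
  ext W
  rw [mem_singleton]
  constructor
  · intro hW
    obtain ⟨w, hw⟩ := π.1.nonempty_of_mem_parts hW
    exact π.1.eq_of_mem_parts hW hV hw (mem_univ w)
  · rintro rfl
    exact hV

variable {R : Type*} [CommRing R]

lemma sum_le_prod_eq (f : Finset (Fin n) → R) (σ : NC n)
    [DecidableRel ((· ≤ ·) : NC n → NC n → Prop)] :
    ∑ π ∈ univ.filter (· ≤ σ), ∏ V ∈ π.1.parts, f V = ∏ V ∈ σ.1.parts, ncSum f V := by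
  classical
  rw [← sum_refining_eq_prod f σ.1.parts univ σ.isNCPartition]
  refine sum_bij (fun π _ => π.1.parts) ?_ ?_ ?_ ?_
  · intro π hπ
    exact (mem_filter).2
      ⟨mem_ncPartitions.2 π.isNCPartition, (mem_filter.1 hπ).2⟩
  · intro π _ ρ _ h
    exact Subtype.ext (Finpartition.ext h)
  · intro F hF
    obtain ⟨hF, h⟩ := (mem_filter).1 hF
    exact ⟨NC.ofIsNCPartition (mem_ncPartitions.1 hF), mem_filter.2 ⟨mem_univ _, h⟩, rfl⟩
  · intros
    rfl

variable [Algebra ℂ R]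

/-- After exchanging the sums, the coefficient of `g π` is the sum of the Möbius function over `[π,
1]`, which vanishes unless `π = 1`. -/
lemma sum_moeb_one (g : NC n → R) [DecidableRel ((· ≤ ·) : NC n → NC n → Prop)] :
    ∑ σ : NC n, moeb σ (NC.one n) • ∑ π ∈ univ.filter (· ≤ σ), g π = g (NC.one n) := by
  classical
  simp_rw [smul_sum]
  rw [sum_comm' (t' := univ) (s' := fun π => Icc π (NC.one n))]
  · simp_rw [← sum_smul, moeb, IncidenceAlgebra.sum_Icc_mu_left]
    simp
  · intro σ π
    simp [NC.le_one]

/-- Möbius inversion on `NC n` for multiplicative functions. -/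
lemma sum_moeb_prod_ncSum (hn : 1 ≤ n) (f : Finset (Fin n) → R) :
    ∑ σ : NC n, moeb σ (NC.one n) • ∏ V ∈ σ.1.parts, ncSum f V = f univ := by
  classical
  simp_rw [← sum_le_prod_eq]
  rw [sum_moeb_one (fun π => ∏ V ∈ π.1.parts, f V), NC.parts_one hn, prod_singleton]

lemma moeb_one_one : moeb (NC.one n) (NC.one n) = 1 := by
  classical
  simp [moeb]

/-- The free cumulants of a sequence of moments. -/
noncomputable def seqCumulant (m : ℕ → R) (n : ℕ) : R :=
  ∑ σ : NC n, moeb σ (NC.one n) • ∏ V ∈ σ.1.parts, m V.card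

/-- Cumulants determine moments: `m` and the semicircular sequence give the same value in the
cumulant formula of order `n`. The terms with `σ ≠ 1` involve only blocks of fewer than `n` elements
and agree by induction, so the terms with `σ = 1`, which are the `n`-th moments, agree too. -/
lemma eq_semicircleMoment (m : ℕ → R) (hm : ∀ k, 3 ≤ k → seqCumulant m k = 0) (n : ℕ)
    (hn : 1 ≤ n) : m n = semicircleMoment (seqCumulant m 1) (seqCumulant m 2) n := by
  classical
  induction n using Nat.strong_induction_on with
  | _ n ih =>
    have h := sum_moeb_prod_ncSum hn (fun V => seqCumulant m V.card)
    simp only [ncSum_card _ hm] at h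
    rw [card_univ, Fintype.card_fin] at h
    conv_rhs at h => rw [seqCumulant]
    rw [← add_sum_erase _ _ (mem_univ (NC.one n)), ← add_sum_erase _ _ (mem_univ (NC.one n))] at h
    have h' : ∀ σ ∈ univ.erase (NC.one n),
        moeb σ (NC.one n) • ∏ V ∈ σ.1.parts,
          semicircleMoment (seqCumulant m 1) (seqCumulant m 2) V.card =
        moeb σ (NC.one n) • ∏ V ∈ σ.1.parts, m V.card := by
      intro σ hσ
      congr 1
      refine prod_congr rfl fun V hV => (ih _ ?_ ?_).symm
      · have := card_lt_univ_of_notMem (s := V) (x := ?_) ?_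
        · simpa using this
        · exact (not_forall.1 fun h =>
            NC.ne_univ_of_ne_one hn (ne_of_mem_erase hσ) hV (eq_univ_iff_forall.2 h)).choose
        · exact (not_forall.1 fun h =>
            NC.ne_univ_of_ne_one hn (ne_of_mem_erase hσ) hV (eq_univ_iff_forall.2 h)).choose_spec
      · exact (σ.1.nonempty_of_mem_parts hV).card_pos
    rw [sum_congr rfl h', add_left_inj, moeb_one_one, NC.parts_one hn] at h
    simpa using h.symm

end Moebius

/-! ### Dual numbers and the functional `φ + εφ'`. -/

section DualNumbers

variable {A : Type*} [Ring A] [Algebra ℂ A]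

variable {R : Type*} [CommRing R] [Algebra ℂ R]

/-- The functional `φ + ε φ'`. -/
noncomputable def dualFunctional (ε : R) (φ φ' : A →ₗ[ℂ] ℂ) : A →ₗ[ℂ] R :=
  φ.smulRight 1 + φ'.smulRight ε

lemma dualFunctional_apply (ε : R) (φ φ' : A →ₗ[ℂ] ℂ) (a : A) :
    dualFunctional ε φ φ' a = φ a • (1 : R) + φ' a • ε := rfl

/-- `R` consists of the complex dual numbers with infinitesimal `ε`. -/
structure IsDualNumbers (ε : R) : Prop where
  mul_self : ε * ε = 0
  exists_eq : ∀ r : R, ∃ a b : ℂ, r = a • (1 : R) + b • ε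
  eq_zero : ∀ a b : ℂ, a • (1 : R) + b • ε = 0 → a = 0 ∧ b = 0

lemma IsDualNumbers.ext {ε : R} (hε : IsDualNumbers ε) {a b c d : ℂ}
    (h : a • (1 : R) + b • ε = c • (1 : R) + d • ε) : a = c ∧ b = d := by
  have := hε.eq_zero (a - c) (b - d) (by
    rw [sub_smul, sub_smul, sub_add_sub_comm, h, sub_self])
  exact ⟨sub_eq_zero.1 this.1, sub_eq_zero.1 this.2⟩

lemma isDualNumbers_eps : IsDualNumbers (DualNumber.eps : DualNumber ℂ) where
  mul_self := DualNumber.eps_mul_eps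
  exists_eq r := ⟨r.fst, r.snd, TrivSqZeroExt.ext
    (by simp only [TrivSqZeroExt.fst_add, TrivSqZeroExt.fst_smul, TrivSqZeroExt.fst_one,
      DualNumber.fst_eps, smul_eq_mul, mul_one, mul_zero, add_zero])
    (by simp only [TrivSqZeroExt.snd_add, TrivSqZeroExt.snd_smul, TrivSqZeroExt.snd_one,
      DualNumber.snd_eps, smul_eq_mul, mul_one, mul_zero, zero_add])⟩
  eq_zero a b h := by
    have h1 := congrArg TrivSqZeroExt.fst h
    have h2 := congrArg TrivSqZeroExt.snd h
    simp only [TrivSqZeroExt.fst_add, TrivSqZeroExt.snd_add, TrivSqZeroExt.fst_smul,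
      TrivSqZeroExt.snd_smul, TrivSqZeroExt.fst_one, TrivSqZeroExt.snd_one, DualNumber.fst_eps,
      DualNumber.snd_eps, smul_eq_mul, mul_one, mul_zero, add_zero, zero_add,
      TrivSqZeroExt.fst_zero, TrivSqZeroExt.snd_zero] at h1 h2
    exact ⟨h1, h2⟩

/-- Only terms with at most one factor `ε` survive. The `ε`-coefficient is the inner sum, over one
distinguished block, in the definition of `infCumulant`. -/
lemma IsDualNumbers.prod_eq {ε : R} (hε : IsDualNumbers ε) {ι : Type*} [DecidableEq ι]
    (s : Finset ι) (f g : ι → ℂ) :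
    ∏ i ∈ s, (f i • (1 : R) + g i • ε) =
      (∏ i ∈ s, f i) • (1 : R) + (∑ i ∈ s, g i * ∏ j ∈ s.erase i, f j) • ε := by
  induction s using Finset.induction_on with
  | empty => simp
  | insert a s ha ih =>
    have : ∑ i ∈ s, g i * ∏ j ∈ (insert a s).erase i, f j =
        f a * ∑ i ∈ s, g i * ∏ j ∈ s.erase i, f j := by
      rw [mul_sum]
      refine sum_congr rfl fun i hi => ?_
      have hia : i ≠ a := fun h => ha (h ▸ hi)
      rw [erase_insert_of_ne hia.symm, prod_insert (fun h => ha (mem_of_mem_erase h))]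
      ring
    rw [prod_insert ha, prod_insert ha, sum_insert ha, erase_insert ha, this, ih]
    simp only [add_mul, mul_add, smul_mul_smul_comm, one_mul, mul_one, hε.mul_self, smul_zero,
      add_smul]
    abel

/-- The cumulants of `φ + ε φ'`. -/
lemma IsDualNumbers.sum_moeb_prod {ε : R} (hε : IsDualNumbers ε) (φ φ' : A →ₗ[ℂ] ℂ) {n : ℕ}
    (a : Fin n → A) :
    ∑ σ : NC n, moeb σ (NC.one n) • ∏ V ∈ σ.1.parts, dualFunctional ε φ φ' (blockProd a V) =
      cumulant φ a • (1 : R) + infCumulant φ φ' a • ε := by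
  simp_rw [dualFunctional_apply, hε.prod_eq, smul_add, smul_smul, sum_add_distrib, ← sum_smul,
    mul_sum, ← mul_assoc]
  rfl

end DualNumbers

open scoped TensorProduct

/-! ### Free pairs over a commutative ring and alternating centred words. -/

section Free

variable {R P : Type*} [CommRing R] [Ring P] [Algebra R P]

/-- The list consists of centred elements, taken alternately from the two subalgebras and starting
with an element of `B i`. -/
def AltCentered (φ : P →ₗ[R] R) (B : Fin 2 → Subalgebra R P) : Fin 2 → List P → Prop
  | _, [] => True
  | i, c :: l => c ∈ B i ∧ φ c = 0 ∧ AltCentered φ B (i + 1) l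

/-- Freeness of a pair of subalgebras. -/
def IsFreePair (φ : P →ₗ[R] R) (B : Fin 2 → Subalgebra R P) : Prop :=
  ∀ i l, AltCentered φ B i l → l ≠ [] → φ l.prod = 0

lemma Fin.add_one_add_one (i : Fin 2) : i + 1 + 1 = i := by
  fin_cases i <;> rfl

variable {φ : P →ₗ[R] R} {B : Fin 2 → Subalgebra R P}

/-- A word is cut in two, and `k` lists the left part outwards from the cut. Moving the cut by one
letter is then a matter of `cons`, which is how later inductions proceed. -/
lemma AltCentered.reverse_append {i : Fin 2} {k l : List P} (hk : AltCentered φ B i k)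
    (hl : AltCentered φ B (i + 1) l) : ∃ j, AltCentered φ B j (k.reverse ++ l) := by
  induction k generalizing i l with
  | nil => exact ⟨i + 1, by simpa using hl⟩
  | cons c k ih =>
    have : AltCentered φ B (i + 1 + 1) (c :: l) := by
      rw [Fin.add_one_add_one]
      exact ⟨hk.1, hk.2.1, hl⟩
    obtain ⟨j, hj⟩ := ih hk.2.2 this
    exact ⟨j, by simpa using hj⟩

lemma IsFreePair.reverse_append (hB : IsFreePair φ B) {i : Fin 2} {k l : List P}
    (hk : AltCentered φ B i k) (hl : AltCentered φ B (i + 1) l) (h : k ≠ [] ∨ l ≠ []) :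
    φ (k.reverse.prod * l.prod) = 0 := by
  obtain ⟨j, hj⟩ := hk.reverse_append hl
  rw [← List.prod_append]
  refine hB j _ hj ?_
  simpa [or_iff_not_imp_left] using h

lemma map_sub_map_one (h1 : φ 1 = 1) (c : P) : φ (c - φ c • 1) = 0 := by
  simp [h1]

lemma sub_map_one_mem {S : Subalgebra R P} {c : P} (hc : c ∈ S) : c - φ c • 1 ∈ S :=
  S.sub_mem hc (S.smul_mem S.one_mem _)

/-- Both neighbours of `v` lie in the other subalgebra, so replacing `v` by `v - φ v` yields an
alternating centred word, which has value zero. -/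
lemma IsFreePair.map_mul_mul (hB : IsFreePair φ B) (h1 : φ 1 = 1) {i : Fin 2} {k l : List P}
    (hk : AltCentered φ B (i + 1) k) (hl : AltCentered φ B (i + 1) l) {v : P} (hv : v ∈ B i) :
    φ (k.reverse.prod * (v * l.prod)) = φ v * φ (k.reverse.prod * l.prod) := by
  have h : AltCentered φ B (i + 1 + 1) ((v - φ v • 1) :: l) := by
    rw [Fin.add_one_add_one]
    exact ⟨sub_map_one_mem hv, map_sub_map_one h1 v, hl⟩
  have := hB.reverse_append hk h (Or.inr (by simp))
  rw [List.prod_cons, sub_mul, mul_sub, map_sub, smul_mul_assoc, one_mul, mul_smul_comm, map_smul,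
    smul_eq_mul, sub_eq_zero] at this
  exact this

/-- The algebra generated by two subalgebras is spanned by alternating centred words, up to a left
factor in the second one. -/
lemma span_mul_altCentered (h1 : φ 1 = 1) (hB : Algebra.adjoin R ((B 0 : Set P) ∪ B 1) = ⊤) :
    Submodule.span R {z : P | ∃ c ∈ B 1, ∃ l, AltCentered φ B 0 l ∧ z = c * l.prod} = ⊤ := by
  set M := Submodule.span R {z : P | ∃ c ∈ B 1, ∃ l, AltCentered φ B 0 l ∧ z = c * l.prod}
    with hM
  have hmem : ∀ c ∈ B 1, ∀ l, AltCentered φ B 0 l → c * l.prod ∈ M :=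
    fun c hc l hl => Submodule.subset_span ⟨c, hc, l, hl, rfl⟩
  have hmem0 : ∀ l, AltCentered φ B 0 l → l.prod ∈ M :=
    fun l hl => by simpa using hmem 1 (B 1).one_mem l hl
  have hmem1 : ∀ l, AltCentered φ B 1 l → l.prod ∈ M := by
    intro l hl
    cases l with
    | nil => exact hmem0 [] trivial
    | cons c l =>
      rw [List.prod_cons]
      exact hmem c hl.1 l hl.2.2
  have hleft1 : ∀ c ∈ B 1, ∀ m ∈ M, c * m ∈ M := by
    intro c hc m hm
    refine Submodule.span_induction (p := fun m _ => c * m ∈ M) ?_ (by simp) ?_ ?_ hm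
    · rintro _ ⟨c', hc', l, hl, rfl⟩
      rw [← mul_assoc]
      exact hmem _ ((B 1).mul_mem hc hc') l hl
    · intro x y _ _ hx hy
      rw [mul_add]
      exact M.add_mem hx hy
    · intro r x _ hx
      rw [mul_smul_comm]
      exact M.smul_mem r hx
  have hb : ∀ b ∈ B 0, ∀ l, AltCentered φ B 1 l → b * l.prod ∈ M := by
    intro b hb l hl
    have : b * l.prod = ((b - φ b • 1) :: l).prod + φ b • l.prod := by
      rw [List.prod_cons, sub_mul, smul_mul_assoc, one_mul, sub_add_cancel]
    rw [this]
    exact M.add_mem (hmem0 _ ⟨sub_map_one_mem hb, map_sub_map_one h1 b, hl⟩)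
      (M.smul_mem _ (hmem1 l hl))
  have hleft0 : ∀ b ∈ B 0, ∀ m ∈ M, b * m ∈ M := by
    intro b hb' m hm
    refine Submodule.span_induction (p := fun m _ => b * m ∈ M) ?_ (by simp) ?_ ?_ hm
    · rintro _ ⟨c, hc, l, hl, rfl⟩
      have : b * (c * l.prod) = b * ((c - φ c • 1) :: l).prod + φ c • (b * l.prod) := by
        rw [List.prod_cons, sub_mul, smul_mul_assoc, one_mul, mul_sub, mul_smul_comm,
          sub_add_cancel]
      rw [this]
      refine M.add_mem (hb b hb' _ ⟨sub_map_one_mem hc, map_sub_map_one h1 c, hl⟩)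
        (M.smul_mem _ ?_)
      cases l with
      | nil => exact hb b hb' [] trivial
      | cons d l =>
        rw [List.prod_cons, ← mul_assoc]
        exact hb _ ((B 0).mul_mem hb' hl.1) l hl.2.2
    · intro x y _ _ hx hy
      rw [mul_add]
      exact M.add_mem hx hy
    · intro r x _ hx
      rw [mul_smul_comm]
      exact M.smul_mem r hx
  rw [eq_top_iff]
  rintro p -
  have hp : p ∈ Algebra.adjoin R ((B 0 : Set P) ∪ B 1) := hB ▸ Algebra.mem_top
  -- The span is stable under left multiplication by both generating subalgebras, hence by
  -- everything; it contains `1`.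
  have : ∀ m ∈ M, p * m ∈ M := by
    induction hp using Algebra.adjoin_induction with
    | mem x hx => exact hx.elim (hleft0 x) (hleft1 x)
    | algebraMap r =>
      intro m hm
      rw [← Algebra.smul_def]
      exact M.smul_mem r hm
    | add x y _ _ hx hy =>
      intro m hm
      rw [add_mul]
      exact M.add_mem (hx m hm) (hy m hm)
    | mul x y _ _ hx hy =>
      intro m hm
      rw [mul_assoc]
      exact hx _ (hy m hm)
  simpa using this 1 (hmem0 [] trivial)

/-- The algebra generated by two subalgebras is spanned by alternating centred words, up to a right
factor in the second one. -/
lemma span_altCentered_mul (h1 : φ 1 = 1) (hB : Algebra.adjoin R ((B 0 : Set P) ∪ B 1) = ⊤) :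
    Submodule.span R {z : P | ∃ c ∈ B 1, ∃ l, AltCentered φ B 0 l ∧ z = l.reverse.prod * c} =
      ⊤ := by
  set M := Submodule.span R
    {z : P | ∃ c ∈ B 1, ∃ l, AltCentered φ B 0 l ∧ z = l.reverse.prod * c} with hM
  have hcons : ∀ (c : P) (l : List P), (c :: l).reverse.prod = l.reverse.prod * c :=
    fun c l => by simp
  have hmem : ∀ c ∈ B 1, ∀ l, AltCentered φ B 0 l → l.reverse.prod * c ∈ M :=
    fun c hc l hl => Submodule.subset_span ⟨c, hc, l, hl, rfl⟩
  have hmem0 : ∀ l, AltCentered φ B 0 l → l.reverse.prod ∈ M :=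
    fun l hl => by simpa using hmem 1 (B 1).one_mem l hl
  have hmem1 : ∀ l, AltCentered φ B 1 l → l.reverse.prod ∈ M := by
    intro l hl
    cases l with
    | nil => exact hmem0 [] trivial
    | cons c l =>
      rw [hcons]
      exact hmem c hl.1 l hl.2.2
  have hright1 : ∀ c ∈ B 1, ∀ m ∈ M, m * c ∈ M := by
    intro c hc m hm
    refine Submodule.span_induction (p := fun m _ => m * c ∈ M) ?_ (by simp) ?_ ?_ hm
    · rintro _ ⟨c', hc', l, hl, rfl⟩
      rw [mul_assoc]
      exact hmem _ ((B 1).mul_mem hc' hc) l hl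
    · intro x y _ _ hx hy
      rw [add_mul]
      exact M.add_mem hx hy
    · intro r x _ hx
      rw [smul_mul_assoc]
      exact M.smul_mem r hx
  have hb : ∀ b ∈ B 0, ∀ l, AltCentered φ B 1 l → l.reverse.prod * b ∈ M := by
    intro b hb l hl
    have : l.reverse.prod * b = ((b - φ b • 1) :: l).reverse.prod + φ b • l.reverse.prod := by
      rw [hcons, mul_sub, mul_smul_comm, mul_one, sub_add_cancel]
    rw [this]
    exact M.add_mem (hmem0 _ ⟨sub_map_one_mem hb, map_sub_map_one h1 b, hl⟩)
      (M.smul_mem _ (hmem1 l hl))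
  have hright0 : ∀ b ∈ B 0, ∀ m ∈ M, m * b ∈ M := by
    intro b hb' m hm
    refine Submodule.span_induction (p := fun m _ => m * b ∈ M) ?_ (by simp) ?_ ?_ hm
    · rintro _ ⟨c, hc, l, hl, rfl⟩
      have : l.reverse.prod * c * b =
          ((c - φ c • 1) :: l).reverse.prod * b + φ c • (l.reverse.prod * b) := by
        rw [hcons, mul_sub, mul_smul_comm, mul_one, sub_mul, smul_mul_assoc, sub_add_cancel]
      rw [this]
      refine M.add_mem (hb b hb' _ ⟨sub_map_one_mem hc, map_sub_map_one h1 c, hl⟩)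
        (M.smul_mem _ ?_)
      cases l with
      | nil => exact hb b hb' [] trivial
      | cons d l =>
        rw [hcons, mul_assoc]
        exact hb _ ((B 0).mul_mem hl.1 hb') l hl.2.2
    · intro x y _ _ hx hy
      rw [add_mul]
      exact M.add_mem hx hy
    · intro r x _ hx
      rw [smul_mul_assoc]
      exact M.smul_mem r hx
  rw [eq_top_iff]
  rintro p -
  have hp : p ∈ Algebra.adjoin R ((B 0 : Set P) ∪ B 1) := hB ▸ Algebra.mem_top
  have : ∀ m ∈ M, m * p ∈ M := by
    induction hp using Algebra.adjoin_induction with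
    | mem x hx => exact hx.elim (hright0 x) (hright1 x)
    | algebraMap r =>
      intro m hm
      rw [← Algebra.commutes, ← Algebra.smul_def]
      exact M.smul_mem r hm
    | add x y _ _ hx hy =>
      intro m hm
      rw [mul_add]
      exact M.add_mem (hx m hm) (hy m hm)
    | mul x y _ _ hx hy =>
      intro m hm
      rw [← mul_assoc]
      exact hy _ (hx m hm)
  simpa using this 1 (hmem0 [] trivial)

/-! ### Free difference quotients and the Schwinger-Dyson equation. -/

/-- `D` behaves like the partial free difference quotient with respect to the second of two
subalgebras. -/
structure IsFreeDifference (D : P →ₗ[R] P ⊗[R] P) (B : Fin 2 → Subalgebra R P) : Prop where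
  leibniz : ∀ a b, D (a * b) = D a * (1 ⊗ₜ b) + (a ⊗ₜ 1) * D b
  eq_zero : ∀ b ∈ B 0, D b = 0
  mem_span : ∀ c ∈ B 1, D c ∈
    Submodule.span R {z : P ⊗[R] P | ∃ p ∈ B 1, ∃ q ∈ B 1, z = p ⊗ₜ q}

lemma IsFreeDifference.map_one {D : P →ₗ[R] P ⊗[R] P} (hD : IsFreeDifference D B) : D 1 = 0 :=
  hD.eq_zero 1 (B 0).one_mem

variable (φ) in
/-- The functional `φ ⊗ φ`. -/
noncomputable def tensorSquare : P ⊗[R] P →ₗ[R] R :=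
  LinearMap.mul' R R ∘ₗ TensorProduct.map φ φ

lemma tensorSquare_tmul (p q : P) : tensorSquare φ (p ⊗ₜ q) = φ p * φ q := by
  simp [tensorSquare]

lemma IsFreeDifference.map_eq {D : P →ₗ[R] P ⊗[R] P} (hD : IsFreeDifference D B) {c : P}
    (hc : c ∈ B 1) (F G : P ⊗[R] P →ₗ[R] R)
    (h : ∀ p ∈ B 1, ∀ q ∈ B 1, F (p ⊗ₜ q) = G (p ⊗ₜ q)) : F (D c) = G (D c) := by
  refine LinearMap.eqOn_span (f := F) (g := G) ?_ (hD.mem_span c hc)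
  rintro _ ⟨p, hp, q, hq, rfl⟩
  exact h p hp q hq

/-- By Leibniz, `D` hits one letter of `l` in `B 1` and leaves in the left leg a nonempty
alternating centred word ending in `B 0`, times some `p ∈ B 1`. Its value is `φ p` times zero. The
induction moves letters of `l` into `k`. -/
lemma IsFreePair.tensorSquare_left (hB : IsFreePair φ B) (h1 : φ 1 = 1)
    {D : P →ₗ[R] P ⊗[R] P} (hD : IsFreeDifference D B) {i : Fin 2} {k l : List P}
    (hk : AltCentered φ B i k) (hk0 : k ≠ []) (hl : AltCentered φ B (i + 1) l) (v w : P) :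
    tensorSquare φ ((k.reverse.prod ⊗ₜ v) * D l.prod * (1 ⊗ₜ w)) = 0 := by
  induction l generalizing i k w with
  | nil => simp [hD.map_one]
  | cons c l ih =>
    have h := ih (k := c :: k) (i := i + 1)
      ⟨hl.1, hl.2.1, by rw [Fin.add_one_add_one]; exact hk⟩ (by simp) hl.2.2 w
    rw [List.prod_cons, hD.leibniz, mul_add, add_mul, map_add]
    have e2 : (k.reverse.prod ⊗ₜ[R] v) * (c ⊗ₜ 1 * D l.prod) * 1 ⊗ₜ w =
        ((c :: k).reverse.prod ⊗ₜ[R] v) * D l.prod * 1 ⊗ₜ w := by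
      rw [← mul_assoc (k.reverse.prod ⊗ₜ[R] v), Algebra.TensorProduct.tmul_mul_tmul]
      simp
    have e1 : tensorSquare φ ((k.reverse.prod ⊗ₜ[R] v) * (D c * 1 ⊗ₜ l.prod) * 1 ⊗ₜ w) = 0 := by
      have hi : i = 0 ∨ i = 1 := by fin_cases i <;> simp
      rcases hi with rfl | rfl
      · refine hD.map_eq (c := c) hl.1 (tensorSquare φ ∘ₗ LinearMap.mulRight R (1 ⊗ₜ w) ∘ₗ
          LinearMap.mulLeft R (k.reverse.prod ⊗ₜ[R] v) ∘ₗ LinearMap.mulRight R (1 ⊗ₜ l.prod)) 0 ?_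
        intro p hp q hq
        have h2 := hB.map_mul_mul h1 (i := 1) (k := k) (l := []) hk trivial hp
        have h3 := hB.reverse_append (l := []) hk trivial (Or.inl hk0)
        rw [h3, mul_zero, List.prod_nil, mul_one] at h2
        simp [Algebra.TensorProduct.tmul_mul_tmul, tensorSquare_tmul, h2]
      · rw [hD.eq_zero c hl.1]
        simp
    rw [e1, e2, h, add_zero]

/-- Mirror image of `IsFreePair.tensorSquare_left`: now the right leg vanishes. -/
lemma IsFreePair.tensorSquare_right (hB : IsFreePair φ B) (h1 : φ 1 = 1)
    {D : P →ₗ[R] P ⊗[R] P} (hD : IsFreeDifference D B) {i : Fin 2} {k l : List P}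
    (hl : AltCentered φ B i l) (hl0 : l ≠ []) (hk : AltCentered φ B (i + 1) k) (v w : P) :
    tensorSquare φ ((v ⊗ₜ 1) * D k.reverse.prod * (w ⊗ₜ l.prod)) = 0 := by
  induction k generalizing i l v with
  | nil => simp [hD.map_one]
  | cons c k ih =>
    have h := ih (l := c :: l) (i := i + 1)
      ⟨hk.1, hk.2.1, by rw [Fin.add_one_add_one]; exact hl⟩ (by simp) hk.2.2 v
    have hcons : (c :: k).reverse.prod = k.reverse.prod * c := by simp
    rw [hcons, hD.leibniz, mul_add, add_mul, map_add]
    have e2 : (v ⊗ₜ[R] 1) * (D k.reverse.prod * 1 ⊗ₜ c) * w ⊗ₜ l.prod =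
        (v ⊗ₜ[R] 1) * D k.reverse.prod * w ⊗ₜ (c :: l).prod := by
      rw [mul_assoc, mul_assoc (D _), Algebra.TensorProduct.tmul_mul_tmul, ← mul_assoc]
      simp
    have e1 : tensorSquare φ ((v ⊗ₜ[R] 1) * (k.reverse.prod ⊗ₜ 1 * D c) * w ⊗ₜ l.prod) = 0 := by
      have hi : i = 0 ∨ i = 1 := by fin_cases i <;> simp
      rcases hi with rfl | rfl
      · refine hD.map_eq (c := c) hk.1 (tensorSquare φ ∘ₗ LinearMap.mulRight R (w ⊗ₜ l.prod) ∘ₗ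
          LinearMap.mulLeft R (v ⊗ₜ[R] 1) ∘ₗ LinearMap.mulLeft R (k.reverse.prod ⊗ₜ 1)) 0 ?_
        intro p hp q hq
        have h2 := hB.map_mul_mul h1 (i := 1) (k := []) (l := l) trivial hl hq
        have h3 := hB.reverse_append (i := 1) (k := []) trivial hl (Or.inr hl0)
        rw [h3, mul_zero, List.reverse_nil, List.prod_nil, one_mul] at h2
        simp [Algebra.TensorProduct.tmul_mul_tmul, tensorSquare_tmul, h2]
      · rw [hD.eq_zero c hk.1]
        simp
    rw [e1, e2, h, add_zero]

/-- Here `c` need not be centred, so it is split as `(c - φ c) + φ c`. The first letter of `l` lies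
in `B 0` and is not differentiated; moving it into the left leg makes that leg a nonempty centred
word even for the scalar part. -/
lemma IsFreePair.tensorSquare_left_mul (hB : IsFreePair φ B) (h1 : φ 1 = 1)
    {D : P →ₗ[R] P ⊗[R] P} (hD : IsFreeDifference D B) {c : P} (hc : c ∈ B 1) {l : List P}
    (hl : AltCentered φ B 0 l) (v : P) :
    tensorSquare φ ((c ⊗ₜ v) * D l.prod) = 0 := by
  cases l with
  | nil => simp [hD.map_one]
  | cons b l =>
    have ha : AltCentered φ B 0 [b, c - φ c • 1] :=
      ⟨hl.1, hl.2.1, sub_map_one_mem hc, map_sub_map_one h1 c, trivial⟩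
    have hb : AltCentered φ B 0 [b] := ⟨hl.1, hl.2.1, trivial⟩
    have h2 := hB.tensorSquare_left h1 hD ha (by simp) hl.2.2 v 1
    have h3 := hB.tensorSquare_left h1 hD hb (by simp) hl.2.2 v 1
    have e : (c ⊗ₜ[R] v) * D (b :: l).prod =
        ([b, c - φ c • 1].reverse.prod ⊗ₜ[R] v) * D l.prod * (1 ⊗ₜ 1) +
          φ c • (([b].reverse.prod ⊗ₜ[R] v) * D l.prod * (1 ⊗ₜ 1)) := by
      rw [List.prod_cons, hD.leibniz, hD.eq_zero b hl.1, zero_mul, zero_add, ← mul_assoc,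
        Algebra.TensorProduct.tmul_mul_tmul, ← Algebra.TensorProduct.one_def, mul_one, mul_one,
        mul_one, ← smul_mul_assoc, ← add_mul, TensorProduct.smul_tmul', ← TensorProduct.add_tmul]
      simp [sub_mul]
    rw [e, map_add, map_smul, h2, h3, smul_zero, add_zero]

lemma IsFreePair.tensorSquare_right_mul (hB : IsFreePair φ B) (h1 : φ 1 = 1)
    {D : P →ₗ[R] P ⊗[R] P} (hD : IsFreeDifference D B) {c : P} (hc : c ∈ B 1) {k : List P}
    (hk : AltCentered φ B 0 k) (w : P) :
    tensorSquare φ (D k.reverse.prod * (w ⊗ₜ c)) = 0 := by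
  cases k with
  | nil => simp [hD.map_one]
  | cons b k =>
    have ha : AltCentered φ B 0 [b, c - φ c • 1] :=
      ⟨hk.1, hk.2.1, sub_map_one_mem hc, map_sub_map_one h1 c, trivial⟩
    have hb : AltCentered φ B 0 [b] := ⟨hk.1, hk.2.1, trivial⟩
    have h2 := hB.tensorSquare_right h1 hD ha (by simp) hk.2.2 1 w
    have h3 := hB.tensorSquare_right h1 hD hb (by simp) hk.2.2 1 w
    have hcons : (b :: k).reverse.prod = k.reverse.prod * b := by simp
    have e : D (b :: k).reverse.prod * (w ⊗ₜ[R] c) =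
        (1 ⊗ₜ 1) * D k.reverse.prod * (w ⊗ₜ [b, c - φ c • 1].prod) +
          φ c • ((1 ⊗ₜ 1) * D k.reverse.prod * (w ⊗ₜ [b].prod)) := by
      rw [hcons, hD.leibniz, hD.eq_zero b hk.1, mul_zero, add_zero, mul_assoc,
        Algebra.TensorProduct.tmul_mul_tmul, ← Algebra.TensorProduct.one_def, one_mul, one_mul,
        ← mul_smul_comm, ← mul_add, ← TensorProduct.tmul_smul, ← TensorProduct.tmul_add]
      simp [mul_sub]
    rw [e, map_add, map_smul, h2, h3, smul_zero, add_zero]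

/-- The Schwinger-Dyson equation for an element `x` of the second algebra extends from this algebra
to the algebra generated by a free pair. -/
theorem IsFreePair.schwingerDyson (hB : IsFreePair φ B) (h1 : φ 1 = 1)
    (hgen : Algebra.adjoin R ((B 0 : Set P) ∪ B 1) = ⊤)
    {D : P →ₗ[R] P ⊗[R] P} (hD : IsFreeDifference D B) {x : P} (hx : x ∈ B 1) (μ t : R)
    (hSD : ∀ c ∈ B 1, ∀ c' ∈ B 1, φ (c * x * c') = μ * φ (c * c') +
      t * (tensorSquare φ ((1 ⊗ₜ c) * D c') + tensorSquare φ (D c * (c' ⊗ₜ 1)))) (u w : P) :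
    φ (u * x * w) = μ * φ (u * w) +
      t * (tensorSquare φ ((1 ⊗ₜ u) * D w) + tensorSquare φ (D u * (w ⊗ₜ 1))) := by
  -- By the two spanning lemmas one may take `u = k.reverse.prod * c` and `w = c' * l.prod`.
  -- Derivatives falling on `k` or `l` contribute nothing, and each remaining term is the
  -- corresponding term for `c`, `c'` times `φ (k.reverse.prod * l.prod)`.
  have key : ∀ c ∈ B 1, ∀ k, AltCentered φ B 0 k → ∀ c' ∈ B 1, ∀ l, AltCentered φ B 0 l →
      φ (k.reverse.prod * c * x * (c' * l.prod)) = μ * φ (k.reverse.prod * c * (c' * l.prod)) +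
      t * (tensorSquare φ ((1 ⊗ₜ (k.reverse.prod * c)) * D (c' * l.prod)) +
        tensorSquare φ (D (k.reverse.prod * c) * ((c' * l.prod) ⊗ₜ 1))) := by
    intro c hc k hk c' hc' l hl
    have hK : ∀ v ∈ B 1, φ (k.reverse.prod * (v * l.prod)) =
        φ v * φ (k.reverse.prod * l.prod) := fun v hv =>
      hB.map_mul_mul h1 (i := 1) hk hl hv
    have e1 : φ (k.reverse.prod * c * x * (c' * l.prod)) =
        φ (c * x * c') * φ (k.reverse.prod * l.prod) := by
      rw [← hK _ ((B 1).mul_mem ((B 1).mul_mem hc hx) hc')]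
      simp only [mul_assoc]
    have e2 : φ (k.reverse.prod * c * (c' * l.prod)) =
        φ (c * c') * φ (k.reverse.prod * l.prod) := by
      rw [← hK _ ((B 1).mul_mem hc hc')]
      simp only [mul_assoc]
    have e3 : tensorSquare φ ((1 ⊗ₜ (k.reverse.prod * c)) * D (c' * l.prod)) =
        tensorSquare φ ((1 ⊗ₜ c) * D c') * φ (k.reverse.prod * l.prod) := by
      rw [hD.leibniz, mul_add, map_add, ← mul_assoc (_ ⊗ₜ _) (c' ⊗ₜ 1),
        Algebra.TensorProduct.tmul_mul_tmul, one_mul, mul_one,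
        hB.tensorSquare_left_mul h1 hD hc' hl, add_zero]
      refine hD.map_eq (c := c') hc' (tensorSquare φ ∘ₗ
        LinearMap.mulLeft R (1 ⊗ₜ (k.reverse.prod * c)) ∘ₗ LinearMap.mulRight R (1 ⊗ₜ l.prod))
        (LinearMap.mulRight R (φ (k.reverse.prod * l.prod)) ∘ₗ tensorSquare φ ∘ₗ
          LinearMap.mulLeft R (1 ⊗ₜ c)) ?_
      intro p hp q hq
      have := hK _ ((B 1).mul_mem hc hq)
      simp only [LinearMap.coe_comp, Function.comp_apply, LinearMap.mulRight_apply,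
        LinearMap.mulLeft_apply, Algebra.TensorProduct.tmul_mul_tmul, tensorSquare_tmul, one_mul,
        mul_one]
      rw [mul_assoc (φ p), ← this]
      simp only [mul_assoc]
    have e4 : tensorSquare φ (D (k.reverse.prod * c) * ((c' * l.prod) ⊗ₜ 1)) =
        tensorSquare φ (D c * (c' ⊗ₜ 1)) * φ (k.reverse.prod * l.prod) := by
      rw [hD.leibniz, add_mul, map_add, mul_assoc (D _) (1 ⊗ₜ c),
        Algebra.TensorProduct.tmul_mul_tmul, one_mul, mul_one,
        hB.tensorSquare_right_mul h1 hD hc hk, zero_add]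
      refine hD.map_eq (c := c) hc (tensorSquare φ ∘ₗ
        LinearMap.mulRight R ((c' * l.prod) ⊗ₜ 1) ∘ₗ LinearMap.mulLeft R (k.reverse.prod ⊗ₜ 1))
        (LinearMap.mulRight R (φ (k.reverse.prod * l.prod)) ∘ₗ tensorSquare φ ∘ₗ
          LinearMap.mulRight R (c' ⊗ₜ 1)) ?_
      intro p hp q hq
      have := hK _ ((B 1).mul_mem hp hc')
      simp only [LinearMap.coe_comp, Function.comp_apply, LinearMap.mulRight_apply,
        LinearMap.mulLeft_apply, Algebra.TensorProduct.tmul_mul_tmul, tensorSquare_tmul, one_mul,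
        mul_one]
      rw [mul_right_comm, ← this]
      simp only [mul_assoc]
    rw [e1, e2, e3, e4, hSD c hc c' hc']
    ring
  have hu : u ∈ Submodule.span R
      {z : P | ∃ c ∈ B 1, ∃ l, AltCentered φ B 0 l ∧ z = l.reverse.prod * c} := by
    rw [span_altCentered_mul h1 hgen]; trivial
  have hw : w ∈ Submodule.span R
      {z : P | ∃ c ∈ B 1, ∃ l, AltCentered φ B 0 l ∧ z = c * l.prod} := by
    rw [span_mul_altCentered h1 hgen]; trivial
  induction hu using Submodule.span_induction with
  | zero => simp
  | add u u' _ _ h h' =>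
    simp only [add_mul, map_add, TensorProduct.tmul_add, h, h']
    ring
  | smul r u _ h =>
    simp only [smul_mul_assoc, map_smul, TensorProduct.tmul_smul, h, smul_eq_mul]
    ring
  | mem u hu =>
    obtain ⟨c, hc, k, hk, rfl⟩ := hu
    induction hw using Submodule.span_induction with
    | zero => simp
    | add w w' _ _ h h' =>
      simp only [mul_add, map_add, TensorProduct.add_tmul, h, h']
      ring
    | smul r w _ h =>
      simp only [mul_smul_comm, map_smul, ← TensorProduct.smul_tmul', h, smul_eq_mul]
      ring
    | mem w hw =>
      obtain ⟨c', hc', l, hl, rfl⟩ := hw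
      exact key c hc k hk c' hc' l hl

end Free

/-! ### Ordered products over finite sets. -/

section OrdProd

variable {α P : Type*} [LinearOrder α]

/-- The product of the family `y` over `s`, in increasing order of the indices. -/
def ordProd [Monoid P] (y : α → P) (s : Finset α) : P :=
  ((s.sort (· ≤ ·)).map y).prod

lemma ordProd_empty [Monoid P] (y : α → P) : ordProd y ∅ = 1 := by
  simp [ordProd]

lemma ordProd_insert_min [Monoid P] (y : α → P) {m : α} {s : Finset α} (hm : ∀ a ∈ s, m < a) :
    ordProd y (insert m s) = y m * ordProd y s := by
  rw [ordProd, sort_insert _ (fun a ha => (hm a ha).le) (fun h => lt_irrefl _ (hm m h)),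
    List.map_cons, List.prod_cons, ordProd]

lemma ordProd_singleton [Monoid P] (y : α → P) (m : α) : ordProd y {m} = y m := by
  simp [ordProd]

lemma ordProd_insert_max [Monoid P] (y : α → P) {m : α} {s : Finset α} (hm : ∀ a ∈ s, a < m) :
    ordProd y (insert m s) = ordProd y s * y m := by
  induction s using Finset.induction_on_min with
  | empty => simp [ordProd]
  | insert a s ha ih =>
    have ham : a < m := hm a (mem_insert_self _ _)
    rw [Finset.insert_comm, ordProd_insert_min y (s := insert m s), ordProd_insert_min y ha,
      ih fun b hb => hm b (mem_insert_of_mem hb), mul_assoc]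
    intro b hb
    rcases mem_insert.1 hb with rfl | hb
    exacts [ham, ha b hb]

lemma map_ordProd {Q F : Type*} [Monoid P] [Monoid Q] [FunLike F P Q] [MonoidHomClass F P Q]
    (f : F) (y : α → P) (s : Finset α) : f (ordProd y s) = ordProd (fun a => f (y a)) s := by
  rw [ordProd, ordProd, map_list_prod, List.map_map]
  rfl

variable {R : Type*} [CommRing R] [Ring P] [Algebra R P]

lemma ordProd_mem {S : Subalgebra R P} {y : α → P} (hy : ∀ a, y a ∈ S) (s : Finset α) :
    ordProd y s ∈ S := by
  refine S.list_prod_mem fun z hz => ?_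
  obtain ⟨a, -, rfl⟩ := List.mem_map.1 hz
  exact hy a

lemma IsFreeDifference.map_ordProd {D : P →ₗ[R] P ⊗[R] P} {B : Fin 2 → Subalgebra R P}
    (hD : IsFreeDifference D B) (z : α → P) (s : Finset α) :
    D (ordProd z s) = ∑ k ∈ s, (ordProd z (s.filter (· < k)) ⊗ₜ 1) * D (z k) *
      (1 ⊗ₜ ordProd z (s.filter (k < ·))) := by
  induction s using Finset.induction_on_min with
  | empty => simp [ordProd_empty, hD.map_one]
  | insert m s hm ih =>
    have hms : m ∉ s := fun h => lt_irrefl _ (hm m h)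
    rw [ordProd_insert_min z hm, hD.leibniz, sum_insert hms, ih, mul_sum]
    congr 1
    · rw [filter_insert, if_neg (lt_irrefl m), filter_false_of_mem fun a ha => lt_asymm (hm a ha),
        filter_insert, if_neg (lt_irrefl m), filter_true_of_mem hm, ordProd_empty,
        ← Algebra.TensorProduct.one_def, one_mul]
    · refine sum_congr rfl fun k hk => ?_
      rw [filter_insert, if_pos (hm k hk), filter_insert, if_neg (lt_asymm (hm k hk)),
        ordProd_insert_min z fun a ha => hm a (mem_filter.1 ha).1, ← mul_assoc, ← mul_assoc,
        Algebra.TensorProduct.tmul_mul_tmul, one_mul]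

end OrdProd

/-! ### The free algebra, its free difference quotient and the semicircular letter. -/

section FreeAlgebra

variable (R : Type*) [CommRing R] (ι : Type*)

/-- The letters of the free algebra that are different from the distinguished one generate the
first subalgebra, the distinguished letter `none` generates the second. -/
def letterSubalgebra : Fin 2 → Subalgebra R (FreeAlgebra R (Option ι)) :=
  ![Algebra.adjoin R (Set.range fun i => FreeAlgebra.ι R (some i)),
    Algebra.adjoin R {FreeAlgebra.ι R none}]

lemma adjoin_letterSubalgebra :
    Algebra.adjoin R ((letterSubalgebra R ι 0 : Set (FreeAlgebra R (Option ι))) ∪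
      letterSubalgebra R ι 1) = ⊤ := by
  rw [eq_top_iff, ← FreeAlgebra.adjoin_range_ι]
  refine Algebra.adjoin_mono ?_
  rintro _ ⟨o, rfl⟩
  cases o with
  | none => exact Or.inr (Algebra.subset_adjoin rfl)
  | some i => exact Or.inl (Algebra.subset_adjoin ⟨i, rfl⟩)

open Classical in
/-- An upper triangular representation of the free algebra, which contains the free difference
quotient with respect to the distinguished letter. -/
noncomputable def triangularHom : FreeAlgebra R (Option ι) →ₐ[R]
    Matrix (Fin 2) (Fin 2) (FreeAlgebra R (Option ι) ⊗[R] FreeAlgebra R (Option ι)) :=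
  FreeAlgebra.lift R fun o =>
    !![FreeAlgebra.ι R o ⊗ₜ 1, if o = none then 1 else 0; 0, 1 ⊗ₜ FreeAlgebra.ι R o]

lemma triangularHom_apply (p : FreeAlgebra R (Option ι)) :
    triangularHom R ι p 0 0 = p ⊗ₜ 1 ∧ triangularHom R ι p 1 0 = 0 ∧
      triangularHom R ι p 1 1 = 1 ⊗ₜ p := by
  induction p using FreeAlgebra.induction with
  | grade0 r =>
    simp [Algebra.algebraMap_eq_smul_one, Algebra.TensorProduct.one_def, TensorProduct.smul_tmul',
      TensorProduct.tmul_smul]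
  | grade1 o => simp [triangularHom]
  | mul a b ha hb =>
    simp [Matrix.mul_apply, Fin.sum_univ_two, ha, hb, Algebra.TensorProduct.tmul_mul_tmul]
  | add a b ha hb =>
    simp [ha, hb, TensorProduct.add_tmul, TensorProduct.tmul_add]

/-- The free difference quotient with respect to the distinguished letter. -/
noncomputable def freeDifference : FreeAlgebra R (Option ι) →ₗ[R]
    FreeAlgebra R (Option ι) ⊗[R] FreeAlgebra R (Option ι) where
  toFun p := triangularHom R ι p 0 1
  map_add' a b := by simp
  map_smul' r a := by simp

/-- This is the corner entry of a product of two upper triangular matrices with diagonals `a ⊗ 1, 1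
⊗ a` and `b ⊗ 1, 1 ⊗ b`. -/
lemma freeDifference_mul (a b : FreeAlgebra R (Option ι)) :
    freeDifference R ι (a * b) =
      freeDifference R ι a * (1 ⊗ₜ b) + (a ⊗ₜ 1) * freeDifference R ι b := by
  obtain ⟨ha, -, -⟩ := triangularHom_apply R ι a
  obtain ⟨-, -, hb⟩ := triangularHom_apply R ι b
  simp [freeDifference, Matrix.mul_apply, Fin.sum_univ_two, ha, hb, add_comm]

lemma freeDifference_algebraMap (r : R) : freeDifference R ι (algebraMap R _ r) = 0 := by
  simp [freeDifference, Matrix.algebraMap_matrix_apply]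

lemma freeDifference_none : freeDifference R ι (FreeAlgebra.ι R none) = 1 := by
  simp [freeDifference, triangularHom]

lemma freeDifference_some (i : ι) : freeDifference R ι (FreeAlgebra.ι R (some i)) = 0 := by
  simp [freeDifference, triangularHom]

lemma isFreeDifference : IsFreeDifference (freeDifference R ι) (letterSubalgebra R ι) where
  leibniz := freeDifference_mul R ι
  eq_zero b hb := by
    refine Algebra.adjoin_induction (p := fun b _ => freeDifference R ι b = 0) ?_ ?_ ?_ ?_ hb
    · rintro _ ⟨i, rfl⟩
      exact freeDifference_some R ι i
    · exact freeDifference_algebraMap R ι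
    · intro x y _ _ hx hy
      rw [map_add, hx, hy, add_zero]
    · intro x y _ _ hx hy
      rw [freeDifference_mul, hx, hy, zero_mul, mul_zero, add_zero]
  mem_span c hc := by
    set M := Submodule.span R {z | ∃ p ∈ letterSubalgebra R ι 1, ∃ q ∈ letterSubalgebra R ι 1,
      z = p ⊗ₜ[R] q}
    have hmul : ∀ z ∈ M, ∀ a ∈ letterSubalgebra R ι 1, ∀ b ∈ letterSubalgebra R ι 1,
        (a ⊗ₜ 1) * z * (1 ⊗ₜ b) ∈ M := by
      intro z hz a ha b hb
      induction hz using Submodule.span_induction with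
      | zero => simp
      | add x y _ _ hx hy =>
        rw [mul_add, add_mul]
        exact M.add_mem hx hy
      | smul r x _ hx =>
        rw [mul_smul_comm, smul_mul_assoc]
        exact M.smul_mem r hx
      | mem z hz =>
        obtain ⟨p, hp, q, hq, rfl⟩ := hz
        refine Submodule.subset_span ⟨a * p, mul_mem ha hp, q * b, mul_mem hq hb, ?_⟩
        simp [Algebra.TensorProduct.tmul_mul_tmul]
    have hc' : c ∈ Algebra.adjoin R {FreeAlgebra.ι R (none : Option ι)} := hc
    induction hc' using Algebra.adjoin_induction with
    | mem x hx =>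
      rw [Set.mem_singleton_iff.1 hx, freeDifference_none]
      exact Submodule.subset_span ⟨1, one_mem _, 1, one_mem _, rfl⟩
    | algebraMap r =>
      rw [freeDifference_algebraMap]
      exact M.zero_mem
    | add x y hx hy ihx ihy =>
      rw [map_add]
      exact M.add_mem (ihx hx) (ihy hy)
    | mul x y hx hy ihx ihy =>
      rw [freeDifference_mul]
      refine M.add_mem ?_ ?_
      · simpa [← Algebra.TensorProduct.one_def] using hmul _ (ihx hx) 1 (one_mem _) y hy
      · simpa [← Algebra.TensorProduct.one_def] using hmul _ (ihy hy) x hx 1 (one_mem _)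

lemma freeDifference_none_pow (n : ℕ) :
    freeDifference R ι (FreeAlgebra.ι R none ^ n) =
      ∑ i ∈ range n, (FreeAlgebra.ι R none ^ i) ⊗ₜ (FreeAlgebra.ι R none ^ (n - 1 - i)) := by
  induction n with
  | zero => simpa using freeDifference_algebraMap R ι 1
  | succ n ih =>
    rw [pow_succ, freeDifference_mul, ih, freeDifference_none, mul_one, sum_range_succ, sum_mul]
    congr 1
    · refine sum_congr rfl fun i hi => ?_
      have := mem_range.1 hi
      rw [Algebra.TensorProduct.tmul_mul_tmul, mul_one, ← pow_succ]
      congr 2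
      omega
    · simp

variable {R ι}

lemma mem_letterSubalgebra_one_induction {p : FreeAlgebra R (Option ι) → Prop}
    (hpow : ∀ n, p (FreeAlgebra.ι R none ^ n)) (h0 : p 0) (hadd : ∀ a b, p a → p b → p (a + b))
    (hsmul : ∀ (r : R) a, p a → p (r • a)) {c : FreeAlgebra R (Option ι)}
    (hc : c ∈ letterSubalgebra R ι 1) : p c := by
  have hc' : c ∈ Submodule.span R
      (Submonoid.closure {FreeAlgebra.ι R (none : Option ι)} : Set (FreeAlgebra R (Option ι))) := by
    rw [← Algebra.adjoin_eq_span]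
    exact hc
  refine Submodule.span_induction (p := fun a _ => p a) ?_ h0 (fun a b _ _ => hadd a b)
    (fun r a _ => hsmul r a) hc'
  intro a ha
  obtain ⟨n, rfl⟩ := Submonoid.mem_closure_singleton.1 ha
  exact hpow n

variable {φ : FreeAlgebra R (Option ι) →ₗ[R] R}

/-- By linearity it suffices to take `c = xⁱ` and `c' = xʲ`. The equation is then the recursion for
the moment of order `i + j + 1`, with its convolution sum split after the first `j` terms: these
come from `D c'`, the last `i` from `D c`. -/
lemma schwingerDyson_of_moments (μ t : R)
    (hφ : ∀ n, φ (FreeAlgebra.ι R none ^ n) = semicircleMoment μ t n)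
    {c c' : FreeAlgebra R (Option ι)} (hc : c ∈ letterSubalgebra R ι 1)
    (hc' : c' ∈ letterSubalgebra R ι 1) :
    φ (c * FreeAlgebra.ι R none * c') = μ * φ (c * c') +
      t * (tensorSquare φ ((1 ⊗ₜ c) * freeDifference R ι c') +
        tensorSquare φ (freeDifference R ι c * (c' ⊗ₜ 1))) := by
  refine mem_letterSubalgebra_one_induction (p := fun c => φ (c * FreeAlgebra.ι R none * c') =
    μ * φ (c * c') + t * (tensorSquare φ ((1 ⊗ₜ c) * freeDifference R ι c') +
      tensorSquare φ (freeDifference R ι c * (c' ⊗ₜ 1)))) ?_ (by simp) ?_ ?_ hc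
  · intro i
    refine mem_letterSubalgebra_one_induction (p := fun c' =>
      φ (FreeAlgebra.ι R none ^ i * FreeAlgebra.ι R none * c') =
        μ * φ (FreeAlgebra.ι R none ^ i * c') +
          t * (tensorSquare φ ((1 ⊗ₜ[R] (FreeAlgebra.ι R none ^ i)) * freeDifference R ι c') +
            tensorSquare φ (freeDifference R ι (FreeAlgebra.ι R none ^ i) * (c' ⊗ₜ[R] 1))))
      ?_ (by simp) ?_ ?_ hc'
    · intro j
      rw [← pow_succ, ← pow_add, ← pow_add, hφ, hφ, freeDifference_none_pow,
        freeDifference_none_pow, show i + 1 + j = (j + i) + 1 by ring, semicircleMoment_succ,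
        sum_range_add, mul_sum, map_sum, sum_mul, map_sum, add_comm i j]
      congr 3
      · refine sum_congr rfl fun q hq => ?_
        have := mem_range.1 hq
        rw [Algebra.TensorProduct.tmul_mul_tmul, one_mul, tensorSquare_tmul, ← pow_add, hφ, hφ]
        congr 2
        omega
      · refine sum_congr rfl fun q hq => ?_
        have := mem_range.1 hq
        rw [Algebra.TensorProduct.tmul_mul_tmul, mul_one, tensorSquare_tmul, ← pow_add, hφ, hφ,
          add_comm j q]
        congr 2
        omega
    · intro a b ha hb
      simp only [mul_add, map_add, TensorProduct.add_tmul, ha, hb]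
      ring
    · intro r a ha
      simp only [mul_smul_comm, map_smul, ← TensorProduct.smul_tmul', ha, smul_eq_mul]
      ring
  · intro a b ha hb
    simp only [add_mul, map_add, TensorProduct.tmul_add, ha, hb]
    ring
  · intro r a ha
    simp only [smul_mul_assoc, map_smul, TensorProduct.tmul_smul, ha, smul_eq_mul]
    ring

/-! ### Parity in the semicircular letter modulo its mean. -/

variable (R ι) in
/-- The automorphism of the free algebra that changes the sign of the distinguished letter. -/
noncomputable def signHom : FreeAlgebra R (Option ι) →ₐ[R] FreeAlgebra R (Option ι) :=
  FreeAlgebra.lift R fun o => o.elim (-FreeAlgebra.ι R none) fun i => FreeAlgebra.ι R (some i)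

lemma signHom_none : signHom R ι (FreeAlgebra.ι R none) = -FreeAlgebra.ι R none := by
  simp [signHom]

lemma signHom_some (i : ι) :
    signHom R ι (FreeAlgebra.ι R (some i)) = FreeAlgebra.ι R (some i) := by
  simp [signHom]

lemma signHom_of_mem_zero {b : FreeAlgebra R (Option ι)} (hb : b ∈ letterSubalgebra R ι 0) :
    signHom R ι b = b := by
  refine Algebra.adjoin_induction (p := fun b _ => signHom R ι b = b) ?_ ?_ ?_ ?_ hb
  · rintro _ ⟨i, rfl⟩
    exact signHom_some i
  · exact AlgHom.commutes _
  · intro x y _ _ hx hy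
    rw [map_add, hx, hy]
  · intro x y _ _ hx hy
    rw [map_mul, hx, hy]

lemma signHom_mem_one {c : FreeAlgebra R (Option ι)} (hc : c ∈ letterSubalgebra R ι 1) :
    signHom R ι c ∈ letterSubalgebra R ι 1 := by
  refine mem_letterSubalgebra_one_induction
    (p := fun c => signHom R ι c ∈ letterSubalgebra R ι 1) (fun n => ?_) (by simp) ?_ ?_ hc
  · rw [map_pow, signHom_none]
    have h : FreeAlgebra.ι R none ∈ letterSubalgebra R ι 1 := Algebra.subset_adjoin rfl
    exact (letterSubalgebra R ι 1).pow_mem ((letterSubalgebra R ι 1).neg_mem h) n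
  · intro a b ha hb
    rw [map_add]
    exact add_mem ha hb
  · intro r a ha
    rw [map_smul]
    exact Subalgebra.smul_mem _ ha r

/-- In each product of the recursion the orders add up to the odd number `n - 2`, so one of the
factors has odd order. -/
lemma semicircleMoment_odd_mem (μ t : R) (n : ℕ) (hn : Odd n) :
    semicircleMoment μ t n ∈ Ideal.span {μ} := by
  induction n using Nat.strong_induction_on with
  | _ n ih =>
    cases n with
    | zero => simp at hn
    | succ k =>
      rw [semicircleMoment_succ]
      refine Ideal.add_mem _ (Ideal.mul_mem_right _ _ (Ideal.mem_span_singleton_self μ))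
        (Ideal.mul_mem_left _ _ (Ideal.sum_mem _ fun i hi => ?_))
      have hik := mem_range.1 hi
      rcases Nat.even_or_odd i with h | h
      · refine Ideal.mul_mem_left _ _ (ih _ (by omega) ?_)
        rw [Nat.odd_iff] at hn ⊢
        rw [Nat.even_iff] at h
        omega
      · exact Ideal.mul_mem_right _ _ (ih _ (by omega) h)

lemma signHom_sub_mem_of_mem_one (μ t : R)
    (hφ : ∀ n, φ (FreeAlgebra.ι R none ^ n) = semicircleMoment μ t n)
    {c : FreeAlgebra R (Option ι)} (hc : c ∈ letterSubalgebra R ι 1) :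
    φ (signHom R ι c) - φ c ∈ Ideal.span {μ} := by
  refine mem_letterSubalgebra_one_induction
    (p := fun c => φ (signHom R ι c) - φ c ∈ Ideal.span {μ}) (fun n => ?_) (by simp) ?_ ?_ hc
  · rw [map_pow, signHom_none]
    rcases Nat.even_or_odd n with h | h
    · simp [h.neg_pow]
    · rw [h.neg_pow, map_neg, hφ]
      exact sub_mem (neg_mem (semicircleMoment_odd_mem μ t n h)) (semicircleMoment_odd_mem μ t n h)
  · intro a b ha hb
    rw [map_add, map_add, map_add, add_sub_add_comm]
    exact add_mem ha hb
  · intro r a ha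
    rw [map_smul, map_smul, map_smul, ← smul_sub]
    exact Ideal.mul_mem_left _ _ ha

/-- The sign change preserves both subalgebras but centring only modulo `μ`. Letters are
transformed, recentred and moved into `k` one by one; each correction is a multiple of `φ (signHom R
ι c) ∈ (μ)`. -/
lemma IsFreePair.map_signHom_altCentered_mem (hB : IsFreePair φ (letterSubalgebra R ι))
    (h1 : φ 1 = 1) (μ t : R)
    (hφ : ∀ n, φ (FreeAlgebra.ι R none ^ n) = semicircleMoment μ t n) {i : Fin 2}
    {k l : List (FreeAlgebra R (Option ι))} (hk : AltCentered φ (letterSubalgebra R ι) i k)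
    (hl : AltCentered φ (letterSubalgebra R ι) (i + 1) l) (h : k ≠ [] ∨ l ≠ []) :
    φ (k.reverse.prod * signHom R ι l.prod) ∈ Ideal.span {μ} := by
  induction l generalizing i k with
  | nil =>
    rw [List.prod_nil, _root_.map_one]
    have := hB.reverse_append (l := []) hk trivial h
    rw [List.prod_nil] at this
    rw [this]
    exact zero_mem _
  | cons c l ih =>
    have hc : signHom R ι c ∈ letterSubalgebra R ι (i + 1) ∧
        φ (signHom R ι c) ∈ Ideal.span {μ} := by
      have hi : i = 0 ∨ i = 1 := by fin_cases i <;> simp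
      rcases hi with rfl | rfl
      · have := signHom_sub_mem_of_mem_one μ t hφ (c := c) hl.1
        rw [hl.2.1, sub_zero] at this
        exact ⟨signHom_mem_one hl.1, this⟩
      · rw [signHom_of_mem_zero (b := c) hl.1, hl.2.1]
        exact ⟨hl.1, zero_mem _⟩
    have e : k.reverse.prod * signHom R ι (c :: l).prod =
        ((signHom R ι c - φ (signHom R ι c) • 1) :: k).reverse.prod * signHom R ι l.prod +
          φ (signHom R ι c) • (k.reverse.prod * signHom R ι l.prod) := by
      rw [List.prod_cons, map_mul, List.reverse_cons, List.prod_append, List.prod_singleton,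
        mul_sub, sub_mul, mul_smul_comm, mul_one, smul_mul_assoc, sub_add_cancel, mul_assoc]
    rw [e, map_add, map_smul]
    refine add_mem (ih (i := i + 1) ⟨sub_map_one_mem hc.1, map_sub_map_one h1 _, ?_⟩ hl.2.2
      (Or.inl (by simp))) (Ideal.mul_mem_right _ _ hc.2)
    rw [Fin.add_one_add_one]
    exact hk

/-- Modulo `μ` the distribution of `x` is symmetric, and freeness carries this symmetry over to
words that also contain the other letters. -/
lemma IsFreePair.map_signHom_sub_mem (hB : IsFreePair φ (letterSubalgebra R ι))
    (h1 : φ 1 = 1) (μ t : R)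
    (hφ : ∀ n, φ (FreeAlgebra.ι R none ^ n) = semicircleMoment μ t n)
    (p : FreeAlgebra R (Option ι)) : φ (signHom R ι p) - φ p ∈ Ideal.span {μ} := by
  have hp : p ∈ Submodule.span R {z | ∃ c ∈ letterSubalgebra R ι 1, ∃ l,
      AltCentered φ (letterSubalgebra R ι) 0 l ∧ z = c * l.prod} := by
    rw [span_mul_altCentered h1 (adjoin_letterSubalgebra R ι)]; trivial
  induction hp using Submodule.span_induction with
  | zero => simp
  | add a b _ _ ha hb =>
    rw [map_add, map_add, map_add, add_sub_add_comm]
    exact add_mem ha hb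
  | smul r a _ ha =>
    rw [map_smul, map_smul, map_smul, ← smul_sub]
    exact Ideal.mul_mem_left _ _ ha
  | mem p hp =>
    obtain ⟨c, hc, l, hl, rfl⟩ := hp
    by_cases hl0 : l = []
    · subst hl0
      simpa using signHom_sub_mem_of_mem_one μ t hφ hc
    · have hz : φ (c * l.prod) = 0 := by
        have h2 := hB.map_mul_mul h1 (i := 1) (k := []) (l := l) trivial hl hc
        have h3 := hB.reverse_append (i := 1) (k := []) trivial hl (Or.inr hl0)
        rw [h3, mul_zero, List.reverse_nil, List.prod_nil, one_mul] at h2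
        exact h2
      have hk : AltCentered φ (letterSubalgebra R ι) 1
          [signHom R ι c - φ (signHom R ι c) • 1] :=
        ⟨sub_map_one_mem (signHom_mem_one hc), map_sub_map_one h1 _, trivial⟩
      have h2 := hB.map_signHom_altCentered_mem h1 μ t hφ hk hl (Or.inl (by simp))
      have h3 := hB.map_signHom_altCentered_mem h1 μ t hφ (i := 1) (k := []) trivial hl
        (Or.inr hl0)
      rw [hz, sub_zero]
      have e : signHom R ι (c * l.prod) =
          [signHom R ι c - φ (signHom R ι c) • 1].reverse.prod * signHom R ι l.prod +
            φ (signHom R ι c) • (([] : List (FreeAlgebra R (Option ι))).reverse.prod *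
              signHom R ι l.prod) := by
        simp [sub_mul]
      rw [e, map_add, map_smul]
      exact add_mem h2 (Ideal.mul_mem_left _ _ h3)

/-- Words which are odd in the distinguished letter have moments divisible by the mean. -/
lemma IsFreePair.map_mem_of_odd (hB : IsFreePair φ (letterSubalgebra R ι))
    (h1 : φ 1 = 1) (h2 : IsUnit (2 : R)) (μ t : R)
    (hφ : ∀ n, φ (FreeAlgebra.ι R none ^ n) = semicircleMoment μ t n)
    {p : FreeAlgebra R (Option ι)} (hp : signHom R ι p = -p) : φ p ∈ Ideal.span {μ} := by
  have h := hB.map_signHom_sub_mem h1 μ t hφ p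
  rw [hp, map_neg, show -φ p - φ p = -(2 * φ p) by ring, neg_mem_iff] at h
  exact (Ideal.unit_mul_mem_iff_mem _ h2).1 h

/-! ### Moments of the words `x a x`. -/

variable [LinearOrder ι]

variable (R) in
/-- The ordered product of the words `x a x` over the letters `a` in `s`. -/
noncomputable def sandwich (s : Finset ι) : FreeAlgebra R (Option ι) :=
  ordProd (fun i => FreeAlgebra.ι R none * FreeAlgebra.ι R (some i) * FreeAlgebra.ι R none) s

lemma signHom_sandwich (s : Finset ι) : signHom R ι (sandwich R s) = sandwich R s := by
  rw [sandwich, map_ordProd]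
  simp [signHom_none, signHom_some]

lemma freeDifference_sandwich (s : Finset ι) :
    freeDifference R ι (sandwich R s) = ∑ k ∈ s,
      (sandwich R (s.filter (· < k)) ⊗ₜ (FreeAlgebra.ι R (some k) * FreeAlgebra.ι R none *
          sandwich R (s.filter (k < ·))) +
        (sandwich R (s.filter (· < k)) * FreeAlgebra.ι R none * FreeAlgebra.ι R (some k)) ⊗ₜ
          sandwich R (s.filter (k < ·))) := by
  rw [sandwich, (isFreeDifference R ι).map_ordProd]
  refine sum_congr rfl fun k _ => ?_
  rw [freeDifference_mul, freeDifference_mul, freeDifference_none, freeDifference_some, one_mul,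
    mul_zero, add_zero, mul_one, Algebra.TensorProduct.tmul_mul_tmul, mul_add, add_mul,
    Algebra.TensorProduct.tmul_mul_tmul, Algebra.TensorProduct.tmul_mul_tmul,
    Algebra.TensorProduct.tmul_mul_tmul, Algebra.TensorProduct.tmul_mul_tmul]
  simp only [one_mul, mul_one, sandwich, mul_assoc]

/-- Schwinger-Dyson for the second `x`, with `u = x b` and `w = sandwich R s`. Pairing it with the
first `x` gives `φ b * φ (sandwich R s)`, and pairing it with the left `x` of the `k`-th factor
merges `b` with that letter. The mean term and the pairings with a right `x` lie in `(μ²) = 0`, by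
parity. -/
lemma map_sandwich_rec (hB : IsFreePair φ (letterSubalgebra R ι))
    (h1 : φ 1 = 1) (h2 : IsUnit (2 : R)) (μ t : R) (hμ : μ * μ = 0)
    (hφ : ∀ n, φ (FreeAlgebra.ι R none ^ n) = semicircleMoment μ t n)
    {b : FreeAlgebra R (Option ι)} (hb : b ∈ letterSubalgebra R ι 0) (s : Finset ι) :
    φ (FreeAlgebra.ι R none * b * FreeAlgebra.ι R none * sandwich R s) =
      t * (φ b * φ (sandwich R s) + ∑ k ∈ s, φ (sandwich R (s.filter (· < k))) *
        φ (FreeAlgebra.ι R none * (b * FreeAlgebra.ι R (some k)) * FreeAlgebra.ι R none *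
          sandwich R (s.filter (k < ·)))) := by
  have hmem : FreeAlgebra.ι R none ∈ letterSubalgebra R ι 1 := Algebra.subset_adjoin rfl
  have hzero : ∀ r ∈ Ideal.span {μ}, ∀ r' ∈ Ideal.span {μ}, r * r' = 0 := by
    intro r hr r' hr'
    obtain ⟨a, rfl⟩ := Ideal.mem_span_singleton'.1 hr
    obtain ⟨a', rfl⟩ := Ideal.mem_span_singleton'.1 hr'
    rw [mul_mul_mul_comm, hμ, mul_zero]
  have hodd₁ : ∀ s' : Finset ι,
      φ (FreeAlgebra.ι R none * b * sandwich R s') ∈ Ideal.span {μ} := fun s' =>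
    hB.map_mem_of_odd h1 h2 μ t hφ (by
      simp [signHom_none, signHom_sandwich, signHom_of_mem_zero hb])
  have hodd₂ : ∀ (s' : Finset ι) (k : ι), φ (sandwich R s' * FreeAlgebra.ι R none *
      FreeAlgebra.ι R (some k)) ∈ Ideal.span {μ} := fun s' k =>
    hB.map_mem_of_odd h1 h2 μ t hφ (by simp [signHom_none, signHom_sandwich, signHom_some])
  rw [hB.schwingerDyson h1 (adjoin_letterSubalgebra R ι) (isFreeDifference R ι) hmem μ t
      fun c hc c' hc' => schwingerDyson_of_moments μ t hφ hc hc',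
    hzero _ (Ideal.mem_span_singleton_self μ) _ (hodd₁ s), zero_add,
    freeDifference_mul R ι (FreeAlgebra.ι R none) b, freeDifference_none,
    (isFreeDifference R ι).eq_zero b hb, mul_zero, add_zero, one_mul,
    Algebra.TensorProduct.tmul_mul_tmul, tensorSquare_tmul, one_mul, mul_one,
    freeDifference_sandwich, mul_sum, map_sum, add_comm (∑ k ∈ s, _), mul_comm (φ b)]
  congr 2
  refine sum_congr rfl fun k _ => ?_
  rw [mul_add, Algebra.TensorProduct.tmul_mul_tmul, Algebra.TensorProduct.tmul_mul_tmul, one_mul,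
    one_mul, map_add, tensorSquare_tmul, tensorSquare_tmul, hzero _ (hodd₂ _ k) _ (hodd₁ _),
    add_zero]
  simp only [mul_assoc]

/-- The moments of the words `x a x`, where the `a` are free from a semicircular element `x`. -/
theorem map_sandwich (hB : IsFreePair φ (letterSubalgebra R ι))
    (h1 : φ 1 = 1) (h2 : IsUnit (2 : R)) (μ t : R) (hμ : μ * μ = 0)
    (hφ : ∀ n, φ (FreeAlgebra.ι R none ^ n) = semicircleMoment μ t n) (s : Finset ι) :
    φ (sandwich R s) =
      t ^ s.card * ncSum (fun V => φ (ordProd (fun i => FreeAlgebra.ι R (some i)) V)) s := by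
  set f : Finset ι → R := fun V => φ (ordProd (fun i => FreeAlgebra.ι R (some i)) V) with hf
  have hmem : ∀ V : Finset ι, ordProd (fun i => FreeAlgebra.ι R (some i)) V ∈
      letterSubalgebra R ι 0 := ordProd_mem fun i => Algebra.subset_adjoin ⟨i, rfl⟩
  -- The second statement treats a first factor `x a_V x` whose letters have already been merged;
  -- `V` is the initial segment of a block as in `ncSumWith`. This factor accounts for one extra
  -- `t`, whatever the size of `V`.
  have key : ∀ n, (∀ s : Finset ι, s.card = n → φ (sandwich R s) = t ^ n * ncSum f s) ∧
      ∀ V s : Finset ι, s.card = n → V.Nonempty → (∀ v ∈ V, ∀ a ∈ s, v < a) →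
        φ (FreeAlgebra.ι R none * ordProd (fun i => FreeAlgebra.ι R (some i)) V *
          FreeAlgebra.ι R none * sandwich R s) = t ^ (n + 1) * ncSumWith f V s := by
    intro n
    induction n using Nat.strong_induction_on with
    | _ n ih =>
      have hM : ∀ s : Finset ι, s.card = n → φ (sandwich R s) = t ^ n * ncSum f s := by
        intro s hs
        induction s using Finset.induction_on_min with
        | empty => rw [← hs, ncSum_empty, sandwich, ordProd_empty, h1]; simp
        | insert m s hm _ =>
          rw [card_insert_of_notMem fun h => lt_irrefl _ (hm m h)] at hs
          have := (ih s.card (by omega)).2 {m} s rfl (singleton_nonempty m) (by simpa using hm)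
          rw [ncSum_insert_min, ← hs, ← this, sandwich, ordProd_insert_min _ hm,
            ordProd_singleton, sandwich]
      refine ⟨hM, fun V s hs hV hVs => ?_⟩
      rw [map_sandwich_rec hB h1 h2 μ t hμ hφ (hmem V), hM s hs, ncSumWith_rec f hV hVs]
      have : ∀ k ∈ s, φ (sandwich R (s.filter (· < k))) *
          φ (FreeAlgebra.ι R none * (ordProd (fun i => FreeAlgebra.ι R (some i)) V *
            FreeAlgebra.ι R (some k)) * FreeAlgebra.ι R none * sandwich R (s.filter (k < ·))) =
          t ^ n * (ncSum f (s.filter (· < k)) *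
            ncSumWith f (insert k V) (s.filter (k < ·))) := by
        intro k hk
        have hcard := card_filter_lt_add_card_filter_gt hk
        rw [← ordProd_insert_max (fun i => FreeAlgebra.ι R (some i)) fun v hv => hVs v hv k hk,
          (ih _ (by omega)).1 _ rfl, (ih _ (by omega)).2 _ _ rfl (insert_nonempty k V), ← hs,
          ← hcard]
        · ring
        · intro v hv a ha
          obtain ⟨ha, hka⟩ := mem_filter.1 ha
          rcases mem_insert.1 hv with rfl | hv
          exacts [hka, hVs v hv a ha]
      rw [sum_congr rfl this, ← mul_sum]
      ring
  exact (key _).1 s rfl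

end FreeAlgebra

/-! ### Values of alternating words cut at a point. -/

section Alternating

variable {R P : Type*} [CommRing R] [Ring P] [Algebra R P]
  {φ : P →ₗ[R] R} {B : Fin 2 → Subalgebra R P}

lemma Fin.add_ofNat_add_ofNat (i : Fin 2) (a b : ℕ) :
    i + Fin.ofNat 2 a + Fin.ofNat 2 b = i + Fin.ofNat 2 (a + b) := by
  apply Fin.ext
  simp [Fin.val_add, Fin.ofNat]
  omega

lemma altCentered_iff {i : Fin 2} {l : List P} :
    AltCentered φ B i l ↔
      ∀ (j : ℕ) (hj : j < l.length), l[j] ∈ B (i + Fin.ofNat 2 j) ∧ φ l[j] = 0 := by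
  induction l generalizing i with
  | nil => simp [AltCentered]
  | cons c l ih =>
    rw [AltCentered, ih]
    constructor
    · rintro ⟨h1, h2, h3⟩ j hj
      cases j with
      | zero => simpa using ⟨h1, h2⟩
      | succ j =>
        have := h3 j (by simpa using hj)
        rw [show i + 1 = i + Fin.ofNat 2 1 from rfl, Fin.add_ofNat_add_ofNat, add_comm 1] at this
        simpa using this
    · intro h
      have h0 := h 0 (by simp)
      rw [List.getElem_cons_zero] at h0
      refine ⟨by simpa using h0.1, h0.2, fun j hj => ?_⟩
      have := h (j + 1) (by simpa using hj)
      rw [show i + 1 = i + Fin.ofNat 2 1 from rfl, Fin.add_ofNat_add_ofNat, add_comm 1]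
      simpa using this

lemma Fin.ofNat_two_eq {a b : ℕ} (h : a % 2 = b % 2) : Fin.ofNat 2 a = Fin.ofNat 2 b :=
  Fin.ext h

/-- The reversed prefix starts with the letter at position `j - 1`; the index `j + 1` has the same
parity and avoids truncated subtraction at `j = 0`. -/
lemma AltCentered.take_reverse {i : Fin 2} {l : List P} (h : AltCentered φ B i l) {j : ℕ}
    (hj : j ≤ l.length) : AltCentered φ B (i + Fin.ofNat 2 (j + 1)) (l.take j).reverse := by
  rw [altCentered_iff] at h ⊢
  intro q hq
  simp only [List.length_reverse, List.length_take] at hq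
  have h' := h (j - 1 - q) (by omega)
  have e : (l.take j).reverse[q]'(by simpa using hq) = l[j - 1 - q]'(by omega) := by
    rw [List.getElem_reverse, List.getElem_take]
    congr 1
    simp only [List.length_take]
    omega
  rw [e]
  refine ⟨?_, h'.2⟩
  rw [Fin.add_ofNat_add_ofNat, Fin.ofNat_two_eq (b := j - 1 - q)]
  · exact h'.1
  · omega

lemma AltCentered.drop {i : Fin 2} {l : List P} (h : AltCentered φ B i l) (j : ℕ) :
    AltCentered φ B (i + Fin.ofNat 2 j) (l.drop j) := by
  rw [altCentered_iff] at h ⊢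
  intro q hq
  rw [List.length_drop] at hq
  rw [List.getElem_drop, Fin.add_ofNat_add_ofNat]
  exact h (j + q) (by omega)

/-- The two letters at the cut lie in the same subalgebra, so the value of their product factors
out. Peeling off such pairs leaves the empty word or, for unequal lengths, a nonempty alternating
centred one. -/
lemma IsFreePair.map_reverse_mul (hB : IsFreePair φ B) (h1 : φ 1 = 1) {i : Fin 2} {k l : List P}
    (hk : AltCentered φ B i k) (hl : AltCentered φ B i l) :
    φ (k.reverse.prod * l.prod) = if k.length = l.length then
      ∏ q ∈ range k.length, φ (k.getD q 0 * l.getD q 0) else 0 := by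
  induction k generalizing i l with
  | nil =>
    cases l with
    | nil => simp [h1]
    | cons c l => simpa using hB i _ hl (by simp)
  | cons c k ih =>
    cases l with
    | nil =>
      rw [if_neg (by simp)]
      exact hB.reverse_append (l := []) hk trivial (Or.inl (by simp))
    | cons d l =>
      have h := hB.map_mul_mul h1 hk.2.2 hl.2.2 ((B i).mul_mem hk.1 hl.1)
      have e : (c :: k).reverse.prod * (d :: l).prod = k.reverse.prod * (c * d * l.prod) := by
        simp [mul_assoc]
      rw [e, h, ih hk.2.2 hl.2.2, List.length_cons, List.length_cons, prod_range_succ']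
      simp [mul_comm]

end Alternating

/-! ### From infinitesimal freeness to freeness over the dual numbers. -/

section Infinitesimal

variable {A : Type*} [Ring A] [Algebra ℂ A] {φ φ' : A →ₗ[ℂ] ℂ} {B : Fin 2 → Subalgebra ℂ A}

lemma InfinitesimallyFree.map_list_prod (hB : InfinitesimallyFree φ φ' B) {i : Fin 2} {l : List A}
    (hl : AltCentered φ B i l) (hl0 : l ≠ []) :
    φ l.prod = 0 ∧ φ' l.prod = if Odd l.length then
      (∏ q ∈ range (l.length / 2), φ (l.getD q 0 * l.getD (l.length - 1 - q) 0)) *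
        φ' (l.getD (l.length / 2) 0) else 0 := by
  rw [altCentered_iff] at hl
  obtain ⟨h, h'⟩ := hB l.length (List.length_pos_iff.2 hl0) (fun j => i + Fin.ofNat 2 j) l.get
    (fun j k hjk => by
      rw [hjk, ← Fin.add_ofNat_add_ofNat]
      simp)
    (fun j => (hl j j.2).1) (fun j => (hl j j.2).2)
  rw [List.ofFn_get] at h h'
  refine ⟨h, h'.trans ?_⟩
  by_cases hodd : Odd l.length
  · rw [if_pos hodd, if_pos]
    · congr 1
      · refine prod_bij (fun j _ => (j : ℕ)) ?_ ?_ ?_ ?_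
        · intro j hj
          exact mem_range.2 (mem_filter.1 hj).2
        · intro a _ b _ hab
          exact Fin.ext hab
        · intro b hb
          have := mem_range.1 hb
          exact ⟨⟨b, by omega⟩, mem_filter.2 ⟨mem_univ _, this⟩, rfl⟩
        · intro j _
          have e : l.length - 1 - (j : ℕ) = (j.rev : ℕ) := by
            rw [Fin.val_rev]
            omega
          rw [e, List.getD_eq_getElem _ _ j.2, List.getD_eq_getElem _ _ j.rev.2]
          rfl
      · have : l.length / 2 < l.length := Nat.div_lt_self (List.length_pos_iff.2 hl0) one_lt_two
        rw [List.getD_eq_getElem _ _ this]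
        rfl
    -- With two alternating subalgebras and odd length, mirror positions have the same parity, so
    -- the symmetry of the indices is automatic.
    · refine ⟨hodd, fun j => ?_⟩
      congr 1
      apply Fin.ofNat_two_eq
      rw [Fin.val_rev]
      have := j.2
      rw [Nat.odd_iff] at hodd
      omega
  · rw [if_neg hodd, if_neg fun h => hodd h.1]

lemma InfinitesimallyFree.isFreePair (hB : InfinitesimallyFree φ φ' B) : IsFreePair φ B :=
  fun _ _ hl hl0 => (hB.map_list_prod hl hl0).1

/-- Infinitesimal freeness as a derivation rule: `φ'` of an alternating centred word is obtained
by applying `φ'` to one factor and `φ` to the product of the others. -/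
lemma InfinitesimallyFree.map_list_prod_eq_sum (hB : InfinitesimallyFree φ φ' B) (h1 : φ 1 = 1)
    {i : Fin 2} {l : List A} (hl : AltCentered φ B i l) (hl0 : l ≠ []) :
    φ' l.prod = ∑ j ∈ range l.length,
      φ' (l.getD j 0) * φ ((l.take j).prod * (l.drop (j + 1)).prod) := by
  -- Omitting letter `j` leaves two words whose letters pair off only if their lengths agree. Hence
  -- only the middle letter contributes, as in the definition of infinitesimal freeness.
  have hterm : ∀ j < l.length, φ ((l.take j).prod * (l.drop (j + 1)).prod) =
      if l.length = 2 * j + 1 then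
        ∏ q ∈ range j, φ (l.getD (j - 1 - q) 0 * l.getD (j + 1 + q) 0) else 0 := by
    intro j hj
    have h := hB.isFreePair.map_reverse_mul h1 (hl.take_reverse hj.le) (hl.drop (j + 1))
    have hlen : (l.take j).reverse.length = j := by simp [hj.le]
    rw [List.reverse_reverse, hlen, List.length_drop] at h
    rw [h]
    by_cases hn : l.length = 2 * j + 1
    · rw [if_pos (by omega), if_pos hn]
      refine prod_congr rfl fun q hq => ?_
      have hq := mem_range.1 hq
      congr 2
      · rw [List.getD_eq_getElem _ _ (by omega), List.getD_eq_getElem _ _ (by omega),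
          List.getElem_reverse, List.getElem_take]
        congr 1
        simp only [List.length_take]
        omega
      · rw [List.getD_eq_getElem _ _ (by rw [List.length_drop]; omega),
          List.getD_eq_getElem _ _ (by omega), List.getElem_drop]
    · rw [if_neg (by omega), if_neg hn]
  rw [(hB.map_list_prod hl hl0).2]
  by_cases hodd : Odd l.length
  · obtain ⟨m, hm⟩ := hodd
    rw [if_pos ⟨m, hm⟩, sum_eq_single m]
    · rw [hterm m (by omega), if_pos hm, show l.length / 2 = m by omega, mul_comm,
        ← prod_range_reflect]
      congr 1
      refine prod_congr rfl fun q hq => ?_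
      have hq := mem_range.1 hq
      congr 3
      omega
    · intro j hj hjm
      rw [hterm j (mem_range.1 hj), if_neg (by omega), mul_zero]
    · intro h
      exact (h (mem_range.2 (by omega))).elim
  · rw [if_neg hodd]
    refine (sum_eq_zero fun j hj => ?_).symm
    rw [hterm j (mem_range.1 hj), if_neg fun h => hodd ⟨j, h⟩, mul_zero]

/-- The list consists of pairs `(a, b)`, representing the elements `a + ε b`, which are centred
with respect to `φ + ε φ'` and are taken alternately from the two subalgebras. -/
def AltCenteredPairs (φ φ' : A →ₗ[ℂ] ℂ) (B : Fin 2 → Subalgebra ℂ A) :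
    Fin 2 → List (A × A) → Prop
  | _, [] => True
  | i, p :: L => p.1 ∈ B i ∧ p.2 ∈ B i ∧ φ p.1 = 0 ∧ φ p.2 = -φ' p.1 ∧
      AltCenteredPairs φ φ' B (i + 1) L

lemma AltCenteredPairs.altCentered {i : Fin 2} {L : List (A × A)}
    (h : AltCenteredPairs φ φ' B i L) : AltCentered φ B i (L.map Prod.fst) := by
  induction L generalizing i with
  | nil => trivial
  | cons p L ih => exact ⟨h.1, h.2.2.1, ih h.2.2.2.2⟩

/-- The coefficient of `ε` in the product of the elements `a + ε b`. -/
def epsCoeff : List (A × A) → A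
  | [] => 0
  | p :: L => p.2 * (L.map Prod.fst).prod + p.1 * epsCoeff L

/-- In each term one letter `a` is replaced by its companion `b` from the same subalgebra. Its
neighbours being centred letters of the other one, `φ b = -φ' a` factors out. -/
lemma AltCenteredPairs.map_epsCoeff (hB : IsFreePair φ B) (h1 : φ 1 = 1) {i : Fin 2}
    {k : List A} {L : List (A × A)} (hk : AltCentered φ B (i + 1) k)
    (hL : AltCenteredPairs φ φ' B i L) :
    φ (k.reverse.prod * epsCoeff L) = -∑ j ∈ range L.length, φ' ((L.map Prod.fst).getD j 0) *
      φ (k.reverse.prod * (((L.map Prod.fst).take j).prod *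
        ((L.map Prod.fst).drop (j + 1)).prod)) := by
  induction L generalizing i k with
  | nil => simp [epsCoeff]
  | cons p L ih =>
    obtain ⟨h1', h2, h3, h4, h5⟩ := hL
    have h := ih (i := i + 1) (k := p.1 :: k)
      ⟨by rwa [Fin.add_one_add_one], h3, by rwa [Fin.add_one_add_one]⟩ h5
    have hmul := hB.map_mul_mul h1 hk h5.altCentered h2
    have hcons : ∀ z : A, (p.1 :: k).reverse.prod * z = k.reverse.prod * (p.1 * z) := by
      simp [mul_assoc]
    simp only [hcons] at h
    rw [epsCoeff, mul_add, map_add, h, hmul, h4, List.length_cons, sum_range_succ', neg_add,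
      add_comm]
    congr 1
    · simp [mul_assoc]
    · simp

variable {R : Type*} [CommRing R] [Algebra ℂ R] {ε : R}

variable (ε) in
/-- The extension of `φ + ε φ'` to the scalar extension of `A` to the dual numbers. -/
noncomputable def dualExtension (φ φ' : A →ₗ[ℂ] ℂ) : R ⊗[ℂ] A →ₗ[R] R :=
  LinearMap.liftBaseChange R (dualFunctional ε φ φ')

variable (ε) in
/-- The element `a + ε b`. -/
noncomputable def dualElement (p : A × A) : R ⊗[ℂ] A :=
  1 ⊗ₜ p.1 + ε ⊗ₜ p.2

lemma dualElement_mul (hε : IsDualNumbers ε) (p q : A × A) :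
    dualElement ε p * dualElement ε q = dualElement ε (p.1 * q.1, p.2 * q.1 + p.1 * q.2) := by
  simp only [dualElement, mul_add, add_mul, Algebra.TensorProduct.tmul_mul_tmul, one_mul, mul_one,
    hε.mul_self, TensorProduct.zero_tmul, TensorProduct.tmul_add]
  abel

lemma dualElement_add (p q : A × A) :
    dualElement ε p + dualElement ε q = dualElement ε (p + q) := by
  simp only [dualElement, TensorProduct.tmul_add, Prod.fst_add, Prod.snd_add]
  abel

lemma dualElement_one : dualElement ε (1, (0 : A)) = 1 := by
  simp [dualElement, Algebra.TensorProduct.one_def]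

lemma dualElement_algebraMap (a b : ℂ) :
    algebraMap R (R ⊗[ℂ] A) (a • (1 : R) + b • ε) =
      dualElement ε (algebraMap ℂ A a, algebraMap ℂ A b) := by
  rw [Algebra.TensorProduct.algebraMap_apply, Algebra.algebraMap_self_apply, dualElement,
    Algebra.algebraMap_eq_smul_one, Algebra.algebraMap_eq_smul_one, ← TensorProduct.smul_tmul,
    ← TensorProduct.smul_tmul, ← TensorProduct.add_tmul]

lemma dualElement_list_prod (hε : IsDualNumbers ε) (L : List (A × A)) :
    (L.map (dualElement ε)).prod = dualElement ε ((L.map Prod.fst).prod, epsCoeff L) := by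
  induction L with
  | nil => simp [epsCoeff, dualElement_one]
  | cons p L ih => simp [epsCoeff, ih, dualElement_mul hε]

lemma dualExtension_one_tmul (a : A) :
    dualExtension ε φ φ' (1 ⊗ₜ a) = dualFunctional ε φ φ' a := by
  simp [dualExtension]

lemma dualExtension_dualElement (hε : IsDualNumbers ε) (p : A × A) :
    dualExtension ε φ φ' (dualElement ε p) = φ p.1 • (1 : R) + (φ' p.1 + φ p.2) • ε := by
  rw [dualElement, map_add, dualExtension_one_tmul, dualExtension, LinearMap.liftBaseChange_tmul,
    dualFunctional_apply, dualFunctional_apply, smul_add, smul_comm ε, smul_comm ε, smul_eq_mul,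
    smul_eq_mul, hε.mul_self, mul_one, smul_zero, add_zero, add_assoc, ← add_smul]

/-- The scalar part vanishes by freeness. The `ε`-part is `φ'` of the product of the first
components plus `φ` of `epsCoeff`; these cancel by the derivation rule
`InfinitesimallyFree.map_list_prod_eq_sum`. -/
lemma InfinitesimallyFree.dualExtension_prod (hB : InfinitesimallyFree φ φ' B)
    (hε : IsDualNumbers ε) (h1 : φ 1 = 1)
    {i : Fin 2} {L : List (A × A)} (hL : AltCenteredPairs φ φ' B i L) (hL0 : L ≠ []) :
    dualExtension ε φ φ' (L.map (dualElement ε)).prod = 0 := by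
  have hl0 : L.map Prod.fst ≠ [] := by simpa using hL0
  have h := hL.map_epsCoeff hB.isFreePair h1 (k := []) trivial
  have h' := hB.map_list_prod_eq_sum h1 hL.altCentered hl0
  simp only [List.reverse_nil, List.prod_nil, one_mul] at h
  rw [List.length_map] at h'
  rw [dualElement_list_prod hε, dualExtension_dualElement hε, h, ← h',
    (hB.map_list_prod hL.altCentered hl0).1]
  simp

/-- Infinitesimal freeness amounts to freeness over the dual numbers. -/
theorem InfinitesimallyFree.isFreePair_dualExtension (hB : InfinitesimallyFree φ φ' B)
    (hε : IsDualNumbers ε) (h1 : φ 1 = 1) {P : Type*} [Ring P] [Algebra (R) P]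
    (e : P →ₐ[R] R ⊗[ℂ] A) (C : Fin 2 → Subalgebra (R) P)
    (hC : ∀ i, ∀ c ∈ C i, ∃ p : A × A, p.1 ∈ B i ∧ p.2 ∈ B i ∧ e c = dualElement ε p) :
    IsFreePair (dualExtension ε φ φ' ∘ₗ e.toLinearMap) C := by
  have key : ∀ (l : List P) (i : Fin 2), AltCentered (dualExtension ε φ φ' ∘ₗ e.toLinearMap) C i l →
      ∃ L : List (A × A), AltCenteredPairs φ φ' B i L ∧ l.map e = L.map (dualElement ε) := by
    intro l
    induction l with
    | nil => exact fun i _ => ⟨[], trivial, rfl⟩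
    | cons c l ih =>
      rintro i ⟨hc, hc0, hl⟩
      obtain ⟨L, hL, hlL⟩ := ih _ hl
      obtain ⟨p, hp1, hp2, hp⟩ := hC i c hc
      rw [LinearMap.comp_apply, AlgHom.toLinearMap_apply, hp, dualExtension_dualElement hε] at hc0
      obtain ⟨hfst, hsnd⟩ := hε.eq_zero _ _ hc0
      refine ⟨p :: L, ⟨hp1, hp2, hfst, ?_, hL⟩, by simp [hlL, hp]⟩
      rw [eq_neg_iff_add_eq_zero, add_comm]
      exact hsnd
  intro i l hl hl0
  obtain ⟨L, hL, hlL⟩ := key l i hl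
  rw [LinearMap.comp_apply, AlgHom.toLinearMap_apply, ← AlgHom.coe_toRingHom, _root_.map_list_prod, AlgHom.coe_toRingHom, hlL]
  refine hB.dualExtension_prod hε h1 hL ?_
  rintro rfl
  exact hl0 (List.map_eq_nil_iff.1 hlL)

end Infinitesimal

/-! ### The semicircular element over the dual numbers and the cumulants of `x a x`. -/

section Application

variable {A : Type*} [Ring A]

lemma blockProd_const (x : A) {n : ℕ} (V : Finset (Fin n)) :
    blockProd (fun _ => x) V = x ^ V.card := by
  simp [blockProd]

lemma blockProd_univ {n : ℕ} (a : Fin n → A) : blockProd a univ = (List.ofFn a).prod := by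
  rw [blockProd, List.ofFn_eq_map]
  congr 2
  exact Fin.sort_univ n

variable [Algebra ℂ A] {R : Type*} [CommRing R] [Algebra ℂ R] {ε : R}

/-- The elements `a + εb` with `a, b ∈ T` are closed under the algebra operations. This supplies the
hypothesis of `InfinitesimallyFree.isFreePair_dualExtension` for the letter subalgebras. -/
lemma exists_eq_dualElement (hε : IsDualNumbers ε) {P : Type*} [Ring P] [Algebra R P]
    (e : P →ₐ[R] R ⊗[ℂ] A) {s : Set P} {T : Subalgebra ℂ A}
    (hs : ∀ z ∈ s, ∃ a ∈ T, e z = 1 ⊗ₜ a) {c : P} (hc : c ∈ Algebra.adjoin R s) :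
    ∃ p : A × A, p.1 ∈ T ∧ p.2 ∈ T ∧ e c = dualElement ε p := by
  induction hc using Algebra.adjoin_induction with
  | mem z hz =>
    obtain ⟨a, ha, h⟩ := hs z hz
    exact ⟨(a, 0), ha, T.zero_mem, by simp [dualElement, h]⟩
  | algebraMap r =>
    obtain ⟨a, b, rfl⟩ := hε.exists_eq r
    exact ⟨_, T.algebraMap_mem a, T.algebraMap_mem b, by
      rw [AlgHom.commutes, dualElement_algebraMap]⟩
  | add x y _ _ hx hy =>
    obtain ⟨p, hp1, hp2, hp⟩ := hx
    obtain ⟨q, hq1, hq2, hq⟩ := hy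
    exact ⟨p + q, T.add_mem hp1 hq1, T.add_mem hp2 hq2, by
      rw [map_add, hp, hq, dualElement_add]⟩
  | mul x y _ _ hx hy =>
    obtain ⟨p, hp1, hp2, hp⟩ := hx
    obtain ⟨q, hq1, hq2, hq⟩ := hy
    exact ⟨_, T.mul_mem hp1 hq1, T.add_mem (T.mul_mem hp2 hq1) (T.mul_mem hp1 hq2), by
      rw [map_mul, hp, hq, dualElement_mul hε]⟩

lemma one_tmul_ordProd {n : ℕ} (a : Fin n → A) (V : Finset (Fin n)) :
    ordProd (fun i => (1 : R) ⊗ₜ[ℂ] a i) V = 1 ⊗ₜ blockProd a V :=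
  (map_ordProd (Algebra.TensorProduct.includeRight : A →ₐ[ℂ] R ⊗[ℂ] A) a V).symm

lemma IsDualNumbers.isUnit_two (_ : IsDualNumbers ε) : IsUnit (2 : R) := by
  have : IsUnit (algebraMap ℂ R 2) := (IsUnit.mk0 (2 : ℂ) two_ne_zero).map _
  rwa [map_ofNat] at this

/-- Only the linear term of the binomial expansion survives; it is the source of the factor `n` in
the theorem. -/
lemma IsDualNumbers.pow_eq (hε : IsDualNumbers ε) (b : ℂ) (n : ℕ) :
    ((1 : ℂ) • (1 : R) + b • ε) ^ n = (1 : ℂ) • (1 : R) + (n * b) • ε := by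
  induction n with
  | zero => simp
  | succ n ih =>
    rw [pow_succ, ih]
    simp only [add_mul, mul_add, smul_mul_smul_comm, one_mul, mul_one, hε.mul_self, smul_zero,
      Nat.cast_add, Nat.cast_one, add_smul]
    abel

/-- The moments of a standard infinitesimally semicircular element. -/
lemma IsStandardInfSemicircular.exists_moments [StarRing A] {φ φ' : A →ₗ[ℂ] ℂ} {x : A}
    (hx : IsStandardInfSemicircular φ φ' x) (hφ : IsIncps φ φ') (hε : IsDualNumbers ε) :
    ∃ μ : R, μ * μ = 0 ∧ ∀ n, dualFunctional ε φ φ' (x ^ n) =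
      semicircleMoment μ ((1 : ℂ) • (1 : R) + φ' (x ^ 2) • ε) n := by
  set m : ℕ → R := fun n => dualFunctional ε φ φ' (x ^ n) with hm
  have hcum : ∀ n, seqCumulant m n = cumulant φ (fun _ : Fin n => x) • (1 : R) +
      infCumulant φ φ' (fun _ : Fin n => x) • ε := by
    intro n
    rw [← hε.sum_moeb_prod]
    simp_rw [blockProd_const]
    rfl
  have h3 : ∀ n, 3 ≤ n → seqCumulant m n = 0 := by
    intro n hn
    rw [hcum, hx.cumulant_eq_zero n hn, hx.infCumulant_eq_zero n hn, zero_smul, zero_smul,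
      add_zero]
  have hmom : ∀ n, m n = semicircleMoment (seqCumulant m 1) (seqCumulant m 2) n := by
    intro n
    rcases Nat.eq_zero_or_pos n with rfl | hn
    · rw [semicircleMoment_zero]
      simp [hm, dualFunctional_apply, hφ.map_one, hφ.map_one']
    · exact eq_semicircleMoment m h3 n hn
  have e1 : (fun _ : Fin 1 => x) = ![x] := by
    funext i; fin_cases i; rfl
  have e2 : (fun _ : Fin 2 => x) = ![x, x] := by
    funext i; fin_cases i <;> rfl
  have hμ : seqCumulant m 1 * seqCumulant m 1 = 0 := by
    rw [hcum, e1, hx.cumulant_one, zero_smul, zero_add, smul_mul_smul_comm, hε.mul_self,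
      smul_zero]
  -- The second moment is `μ² + t` and `μ² = 0`, so the second cumulant equals the second moment;
  -- its scalar part is `κ₂(x, x) = 1`.
  have ht : seqCumulant m 2 = (1 : ℂ) • (1 : R) + φ' (x ^ 2) • ε := by
    have h2 := hmom 2
    rw [semicircleMoment_succ, semicircleMoment_succ, semicircleMoment_zero] at h2
    simp only [range_zero, sum_empty, mul_zero, add_zero, mul_one, hμ, zero_add, range_one,
      sum_singleton, semicircleMoment_zero, Nat.sub_self] at h2
    have h2' := hcum 2
    rw [← h2, e2, hx.cumulant_two, hm] at h2'
    simp only [dualFunctional_apply] at h2'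
    rw [← h2, hm]
    simp only [dualFunctional_apply]
    rw [(hε.ext h2').1]
  refine ⟨seqCumulant m 1, hμ, fun n => ?_⟩
  rw [← ht]
  exact hmom n

/-- The free cumulants over the dual numbers of the elements `x a x`. -/
theorem sum_moeb_prod_conj [StarRing A] {φ φ' : A →ₗ[ℂ] ℂ} {x : A}
    (hx : IsStandardInfSemicircular φ φ' x) (hφ : IsIncps φ φ') (hε : IsDualNumbers ε)
    {S : Set A} (hS : InfinitesimallyFreeSets φ φ' ![S, {x}]) {n : ℕ} (hn : 1 ≤ n)
    (a : Fin n → A) (ha : ∀ i, a i ∈ S) :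
    ∑ σ : NC n, moeb σ (NC.one n) • ∏ V ∈ σ.1.parts,
        dualFunctional ε φ φ' (blockProd (fun i => x * a i * x) V) =
      ((1 : ℂ) • (1 : R) + φ' (x ^ 2) • ε) ^ n * dualFunctional ε φ φ' (List.ofFn a).prod := by
  obtain ⟨μ, hμ, hmom⟩ := hx.exists_moments hφ hε
  set t := (1 : ℂ) • (1 : R) + φ' (x ^ 2) • ε
  let e : FreeAlgebra R (Option (Fin n)) →ₐ[R] R ⊗[ℂ] A :=
    FreeAlgebra.lift R fun o => o.elim (1 ⊗ₜ x) fun i => 1 ⊗ₜ a i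
  have he_none : e (FreeAlgebra.ι R none) = 1 ⊗ₜ x := by simp [e]
  have he_some : ∀ i, e (FreeAlgebra.ι R (some i)) = 1 ⊗ₜ a i := fun i => by simp [e]
  set ψ := dualExtension ε φ φ' ∘ₗ e.toLinearMap with hψ
  have hψ_apply : ∀ p, ψ p = dualExtension ε φ φ' (e p) := fun p => rfl
  have h1 : ψ 1 = 1 := by
    rw [hψ_apply, _root_.map_one, Algebra.TensorProduct.one_def, dualExtension_one_tmul,
      dualFunctional_apply, hφ.map_one, hφ.map_one', one_smul, zero_smul, add_zero]
  have hfree : IsFreePair ψ (letterSubalgebra R (Fin n)) := by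
    refine InfinitesimallyFree.isFreePair_dualExtension hS hε hφ.map_one e _ fun i c hc => ?_
    have hi : i = 0 ∨ i = 1 := by fin_cases i <;> simp
    rcases hi with rfl | rfl
    · refine exists_eq_dualElement hε e ?_ hc
      rintro _ ⟨i, rfl⟩
      exact ⟨a i, Algebra.subset_adjoin (ha i), he_some i⟩
    · refine exists_eq_dualElement hε e ?_ hc
      rintro _ rfl
      exact ⟨x, Algebra.subset_adjoin rfl, he_none⟩
  have hpow : ∀ k, ψ (FreeAlgebra.ι R none ^ k) = semicircleMoment μ t k := by
    intro k
    rw [hψ_apply, map_pow, he_none, Algebra.TensorProduct.tmul_pow, one_pow,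
      dualExtension_one_tmul, hmom]
  have hletters : ∀ V : Finset (Fin n), ψ (ordProd (fun i => FreeAlgebra.ι R (some i)) V) =
      dualFunctional ε φ φ' (blockProd a V) := by
    intro V
    rw [hψ_apply, map_ordProd]
    simp_rw [he_some]
    rw [one_tmul_ordProd, dualExtension_one_tmul]
  have hsandwich : ∀ V : Finset (Fin n), ψ (sandwich R V) =
      dualFunctional ε φ φ' (blockProd (fun i => x * a i * x) V) := by
    intro V
    rw [hψ_apply, sandwich, map_ordProd]
    simp_rw [map_mul, he_some, he_none, Algebra.TensorProduct.tmul_mul_tmul, mul_one]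
    rw [one_tmul_ordProd, dualExtension_one_tmul]
  have key := map_sandwich hfree h1 hε.isUnit_two μ t hμ hpow
  -- The block sizes of `σ` add up to `n`, so the powers of `t` combine to the same `t ^ n` for
  -- every `σ` and leave the Möbius sum.
  have hprod : ∀ σ : NC n, ∏ V ∈ σ.1.parts,
      dualFunctional ε φ φ' (blockProd (fun i => x * a i * x) V) =
      t ^ n * ∏ V ∈ σ.1.parts, ncSum
        (fun V => ψ (ordProd (fun i => FreeAlgebra.ι R (some i)) V)) V := by
    intro σ
    simp_rw [← hsandwich, key]
    rw [prod_mul_distrib, prod_pow_eq_pow_sum, σ.1.sum_card_parts, card_univ, Fintype.card_fin]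
  simp_rw [hprod, ← mul_smul_comm, ← mul_sum]
  rw [sum_moeb_prod_ncSum hn, hletters, blockProd_univ]

end Application

end InfFree

theorem theorem5p9 {A : Type*} [Ring A] [Algebra ℂ A] [StarRing A] [StarModule ℂ A]
    (φ φ' : A →ₗ[ℂ] ℂ) (hA : InfFree.IsStarIncps φ φ')
    (x : A) (hx : InfFree.IsStandardInfSemicircular φ φ' x)
    (S : Set A) (hS : InfFree.InfinitesimallyFreeSets φ φ' ![S, {x}])
    (n : ℕ) (hn : 1 ≤ n) (a : Fin n → A) (ha : ∀ i, a i ∈ S) :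
    InfFree.cumulant φ (fun i => x * a i * x) = φ (List.ofFn a).prod ∧
    InfFree.infCumulant φ φ' (fun i => x * a i * x) =
      φ' (List.ofFn a).prod + n * φ' (x ^ 2) * φ (List.ofFn a).prod := by
  have hε := InfFree.isDualNumbers_eps
  have h := InfFree.sum_moeb_prod_conj hx hA.toIsIncps hε hS hn a ha
  rw [hε.sum_moeb_prod, hε.pow_eq, InfFree.dualFunctional_apply] at h
  -- Comparing the coefficients of `1` and `ε` yields the two formulas.
  refine hε.ext (h.trans ?_)
  simp only [add_mul, mul_add, smul_mul_smul_comm, one_mul, mul_one, hε.mul_self, smul_zero,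
    add_smul]
  abel
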